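/- Let $k$ be a field of characteristic zero, $v$ an indeterminate, and let $U$ be the $k(v)$-algebra generated by $E,F,K^{\pm1}$ with relations $KK^{-1}=K^{-1}K=1$, $KEK^{-1}=v^2E$, $KFK^{-1}=v^{-2}F$, $EF-FE=\frac{K-K^{-1}}{v-v^{-1}}$. Tensor products are formed with the comultiplication $\Delta(E)=E\otimes1+K\otimes E$, $\Delta(F)=1\otimes F+F\otimes K^{-1}$, $\Delta(K)=K\otimes K$. Let $R=k(v)[[T-1]]$ and ${}_RU=R\otimes_{k(v)}U$. For $m\in\mathbb Z$ and $j\ge0$ put $[m]=\frac{v^m-v^{-m}}{v-v^{-1}}$, $[m]_{(j)}=[m][m-1]\cdots[m-j+1]$, $[j]!=[j]_{(j)}$, $\{j\}=\prod_{a=1}^j(v^a-v^{-a})$, and for $t\in\{T,T^{-1}\}$, $[t;m]=\frac{v^mt-v^{-m}t^{-1}}{v-v^{-1}}$, $[t;m]_{(j)}=[t;m][t;m-1]\cdots[t;m-j+1]$. Put $E^{(j)}=E^j/[j]!$, $F^{(j)}=F^j/[j]!$. Let $M$ be the ${}_RU$-Verma module of highest weight $Tv^{-1}$ with canonical generator $w_{0,-1}$,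 let $M_F$ be its localization with respect to the powers of $F$, and $M_\pi=M_F/\iota M$, where $\iota:M\to M_F$ is the canonical map. Let $\mathcal F=\mathcal F_n$ be the simple module of highest weight $v^n$ (scalars extended to $R$), with basis $u^{(n)}_j=F^{(j)}u^{(n)}$, $0\le j\le n$, $u^{(n)}$ a highest weight vector. On a module put $F^{(-j)}x=T'_{-1}(F^{(j)})x$, where $T'_{-1}$ is Lusztig's automorphism $E\mapsto-K^{-1}F$, $F\mapsto-EK$, $K\mapsto K^{-1}$. A highest (lowest) weight vector of weight $\chi\in R$ is a nonzero vector $x$ with $Ex=0$ ($Fx=0$) and $Kx=\chi x$. On $M_\pi\otimes\mathcal F$ let $$L(x\otimes y)=\sum_{j\ge0}(-1)^jv^{-j(j-1)/2}\{j\}F^{(j)}x\otimes E^{(j)}y.$$ Let $n,p,r$ be nonnegative integers with $n-2p=r$. Then the following hold. (1) $w_{0,-1}$ is a highest weight vector of weight $Tv^{-1}$ in $M$, and the class of $F^{-1}w_{0,-1}$ is a lowest weight vector of weight $Tv$ in $M_\pi$. (2) In $M\otimes\mathcal F$, $$w_{r,r-1}=\sum_{k=0}^{p}\frac{[n-p+k]_{(k)}v^{-k^2}}{T^{-k}[T^{-1};k]_{(k)}}F^{(k)}w_{0,-1}\otimes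 u^{(n)}_{p-k},\qquad w_{-r,-r-1}=\sum_{k=0}^{n-p}\frac{[p+k]_{(k)}v^{-k^2}}{T^{-k}[T^{-1};k]_{(k)}}F^{(k)}w_{0,-1}\otimes u^{(n)}_{n-p-k}$$ are highest weight vectors of weights $Tv^{r-1}$ and $Tv^{-r-1}$ respectively. (3) $L$ is invertible on $M_\pi\otimes\mathcal F$, with two-sided inverse $L^{-1}(x\otimes y)=\sum_{j\ge0}v^{j(j-1)/2}\{j\}F^{(j)}x\otimes E^{(j)}y$. (4) For every lowest weight vector $m_{0,1}$ of weight $Tv$ in $M_\pi$, the vectors $$m_{r,r+1}=\sum_{k=0}^{n-p}(-1)^k\frac{[p+k]_{(k)}v^{-k(-r+2k+1)}}{T^k[T;k]_{(k)}}F^{(-k)}m_{0,1}\otimes u^{(n)}_{p+k},$$ $$m_{-r,-r+1}=\sum_{k=0}^{p}(-1)^k\frac{[n-p+k]_{(k)}v^{-k(r+2k+1)}}{T^k[T;k]_{(k)}}F^{(-k)}m_{0,1}\otimes u^{(n)}_{n-p+k}$$ are lowest weight vectors of $M_\pi\otimes\mathcal F$ of weights $Tv^{r+1}$ and $Tv^{-r+1}$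 respectively, and $$L^{-1}(m_{r,r+1})=v^{-2(n-p)(p+1)}\sum_{s=0}^{n-p}(-1)^s\frac{v^{s(1-r)}[p+s]_{(s)}}{T^s[T;s]_{(s)}}F^{(-s)}m_{0,1}\otimes u^{(n)}_{p+s},$$ $$L^{-1}(m_{-r,-r+1})=v^{-2p(n-p+1)}\sum_{s=0}^{p}(-1)^s\frac{v^{s(1+r)}[n-p+s]_{(s)}}{T^s[T;s]_{(s)}}F^{(-s)}m_{0,1}\otimes u^{(n)}_{n-p+s}.$$ -/

import Mathlib

open scoped TensorProduct

noncomputable section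

namespace QSL2

/-! ### `q`-calculus in the field `k(v)` -/

section Calculus

variable (k : Type*) [Field k]

/-- The indeterminate `v` of `k(v)`. -/
def v : RatFunc k := RatFunc.X

/-- `[m] = (v^m - v^{-m}) / (v - v⁻¹)` for an integer `m`. -/
def qint (m : ℤ) : RatFunc k := (v k ^ m - v k ^ (-m)) / (v k - (v k)⁻¹)

/-- `[m]_{(j)} = [m] [m-1] ⋯ [m-j+1]`. -/
def qfall (m : ℤ) (j : ℕ) : RatFunc k := ∏ i ∈ Finset.range j, qint k (m - i)

/-- `[j]! = [j]_{(j)}`. -/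
def qfact (j : ℕ) : RatFunc k := qfall k j j

/-- `{j} = ∏_{a=1}^{j} (v^a - v^{-a})`. -/
def qbrace (j : ℕ) : RatFunc k :=
  ∏ a ∈ Finset.Icc 1 j, (v k ^ (a : ℤ) - v k ^ (-(a : ℤ)))

end Calculus

/-! ### The quantized enveloping algebra of `sl₂`

`QU k A` is the quantized enveloping algebra with scalars in a commutative `k(v)`-algebra `A`,
given by generators and relations.  For `A = k(v)` it is `U`, and in general it is the extension
of scalars `A ⊗_{k(v)} U` (which has the same presentation over `A`). -/

/-- The generators `E`, `F`, `K`, `K⁻¹`. -/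
inductive Gen : Type
  | E | F | K | Kinv

section Algebra

variable (k : Type*) [Field k] (A : Type*) [CommRing A] [Algebra (RatFunc k) A]

/-- The defining relations. -/
inductive Rel : FreeAlgebra A Gen → FreeAlgebra A Gen → Prop
  | EF : Rel
      (FreeAlgebra.ι A Gen.E * FreeAlgebra.ι A Gen.F -
        FreeAlgebra.ι A Gen.F * FreeAlgebra.ι A Gen.E)
      (algebraMap (RatFunc k) A (v k - (v k)⁻¹)⁻¹ •
        (FreeAlgebra.ι A Gen.K - FreeAlgebra.ι A Gen.Kinv))
  | KE : Rel (FreeAlgebra.ι A Gen.K * FreeAlgebra.ι A Gen.E * FreeAlgebra.ι A Gen.Kinv)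
      (algebraMap (RatFunc k) A (v k ^ (2 : ℤ)) • FreeAlgebra.ι A Gen.E)
  | KF : Rel (FreeAlgebra.ι A Gen.K * FreeAlgebra.ι A Gen.F * FreeAlgebra.ι A Gen.Kinv)
      (algebraMap (RatFunc k) A (v k ^ (-2 : ℤ)) • FreeAlgebra.ι A Gen.F)
  | KKinv : Rel (FreeAlgebra.ι A Gen.K * FreeAlgebra.ι A Gen.Kinv) 1
  | KinvK : Rel (FreeAlgebra.ι A Gen.Kinv * FreeAlgebra.ι A Gen.K) 1

/-- The quantized enveloping algebra of `sl₂` with scalars in `A`. -/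
def QU : Type _ := RingQuot (Rel k A)

instance : Ring (QU k A) := inferInstanceAs (Ring (RingQuot (Rel k A)))

instance : Algebra A (QU k A) := inferInstanceAs (Algebra A (RingQuot (Rel k A)))

/-- The image of a generator. -/
def gen (g : Gen) : QU k A := RingQuot.mkAlgHom A (Rel k A) (FreeAlgebra.ι A g)

abbrev E : QU k A := gen k A Gen.E
abbrev F : QU k A := gen k A Gen.F
abbrev K : QU k A := gen k A Gen.K
abbrev Kinv : QU k A := gen k A Gen.Kinv

theorem rel_EF : E k A * F k A - F k A * E k A =
    algebraMap (RatFunc k) A (v k - (v k)⁻¹)⁻¹ • (K k A - Kinv k A) := by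
  have h := RingQuot.mkAlgHom_rel A (Rel.EF (k := k) (A := A))
  rw [map_sub, map_mul, map_mul, map_smul, map_sub] at h
  exact h

theorem rel_KE : K k A * E k A * Kinv k A =
    algebraMap (RatFunc k) A (v k ^ (2 : ℤ)) • E k A := by
  have h := RingQuot.mkAlgHom_rel A (Rel.KE (k := k) (A := A))
  rw [map_mul, map_mul, map_smul] at h
  exact h

theorem rel_KF : K k A * F k A * Kinv k A =
    algebraMap (RatFunc k) A (v k ^ (-2 : ℤ)) • F k A := by
  have h := RingQuot.mkAlgHom_rel A (Rel.KF (k := k) (A := A))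
  rw [map_mul, map_mul, map_smul] at h
  exact h

theorem rel_KKinv : K k A * Kinv k A = 1 := by
  have h := RingQuot.mkAlgHom_rel A (Rel.KKinv (k := k) (A := A))
  rw [map_mul, map_one] at h
  exact h

theorem rel_KinvK : Kinv k A * K k A = 1 := by
  have h := RingQuot.mkAlgHom_rel A (Rel.KinvK (k := k) (A := A))
  rw [map_mul, map_one] at h
  exact h

/-- Universal property of `QU`: elements of an `A`-algebra that satisfy the defining relations
determine an algebra homomorphism. -/
def lift {B : Type*} [Ring B] [Algebra A B] (e f κ κ' : B)
    (hEF : e * f - f * e = algebraMap (RatFunc k) A (v k - (v k)⁻¹)⁻¹ • (κ - κ'))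
    (hKE : κ * e * κ' = algebraMap (RatFunc k) A (v k ^ (2 : ℤ)) • e)
    (hKF : κ * f * κ' = algebraMap (RatFunc k) A (v k ^ (-2 : ℤ)) • f)
    (hK : κ * κ' = 1) (hK' : κ' * κ = 1) : QU k A →ₐ[A] B :=
  RingQuot.liftAlgHom A
    ⟨FreeAlgebra.lift A (fun g => match g with
      | Gen.E => e
      | Gen.F => f
      | Gen.K => κ
      | Gen.Kinv => κ'), by
      intro x y h
      cases h
      · simpa [-algebraMap_smul] using hEF
      · simpa [-algebraMap_smul] using hKE
      · simpa [-algebraMap_smul, -zpow_neg] using hKF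
      · simpa using hK
      · simpa using hK'⟩

section lift

variable {B : Type*} [Ring B] [Algebra A B] (e f κ κ' : B)
    (hEF : e * f - f * e = algebraMap (RatFunc k) A (v k - (v k)⁻¹)⁻¹ • (κ - κ'))
    (hKE : κ * e * κ' = algebraMap (RatFunc k) A (v k ^ (2 : ℤ)) • e)
    (hKF : κ * f * κ' = algebraMap (RatFunc k) A (v k ^ (-2 : ℤ)) • f)
    (hK : κ * κ' = 1) (hK' : κ' * κ = 1)

theorem lift_E : lift k A e f κ κ' hEF hKE hKF hK hK' (E k A) = e :=
  (RingQuot.liftAlgHom_mkAlgHom_apply A _ _ _).trans (FreeAlgebra.lift_ι_apply _ _)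

theorem lift_F : lift k A e f κ κ' hEF hKE hKF hK hK' (F k A) = f :=
  (RingQuot.liftAlgHom_mkAlgHom_apply A _ _ _).trans (FreeAlgebra.lift_ι_apply _ _)

theorem lift_K : lift k A e f κ κ' hEF hKE hKF hK hK' (K k A) = κ :=
  (RingQuot.liftAlgHom_mkAlgHom_apply A _ _ _).trans (FreeAlgebra.lift_ι_apply _ _)

theorem lift_Kinv : lift k A e f κ κ' hEF hKE hKF hK hK' (Kinv k A) = κ' :=
  (RingQuot.liftAlgHom_mkAlgHom_apply A _ _ _).trans (FreeAlgebra.lift_ι_apply _ _)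

end lift

/-- The divided power `E^{(j)} = E^j / [j]!`. -/
def Ediv (j : ℕ) : QU k A := algebraMap (RatFunc k) A (qfact k j)⁻¹ • E k A ^ j

/-- The divided power `F^{(j)} = F^j / [j]!`. -/
def Fdiv (j : ℕ) : QU k A := algebraMap (RatFunc k) A (qfact k j)⁻¹ • F k A ^ j

theorem K_mul_E : K k A * E k A =
    algebraMap (RatFunc k) A (v k ^ (2 : ℤ)) • (E k A * K k A) := by
  have h := congrArg (· * K k A) (rel_KE k A)
  simpa [mul_assoc, rel_KinvK] using h

theorem K_mul_F : K k A * F k A =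
    algebraMap (RatFunc k) A (v k ^ (-2 : ℤ)) • (F k A * K k A) := by
  have h := congrArg (· * K k A) (rel_KF k A)
  simpa [mul_assoc, rel_KinvK] using h

theorem algebraMap_mul_cancel {a b : RatFunc k} (h : a * b = 1) :
    algebraMap (RatFunc k) A a * algebraMap (RatFunc k) A b = 1 := by
  rw [← map_mul, h, map_one]

theorem v_ne_zero : v k ≠ 0 := RatFunc.X_ne_zero

theorem v_two_mul : v k ^ (2 : ℤ) * v k ^ (-2 : ℤ) = 1 := by
  rw [← zpow_add₀ (v_ne_zero k)]; simp

theorem E_mul_Kinv : E k A * Kinv k A =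
    algebraMap (RatFunc k) A (v k ^ (2 : ℤ)) • (Kinv k A * E k A) := by
  have h := congrArg (Kinv k A * ·) (rel_KE k A)
  simpa [← mul_assoc, rel_KinvK] using h

theorem F_mul_Kinv : F k A * Kinv k A =
    algebraMap (RatFunc k) A (v k ^ (-2 : ℤ)) • (Kinv k A * F k A) := by
  have h := congrArg (Kinv k A * ·) (rel_KF k A)
  simpa [← mul_assoc, rel_KinvK] using h

theorem F_mul_K : F k A * K k A =
    algebraMap (RatFunc k) A (v k ^ (2 : ℤ)) • (K k A * F k A) := by
  rw [K_mul_F, smul_smul, algebraMap_mul_cancel k A (v_two_mul k), one_smul]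

theorem Kinv_mul_E : Kinv k A * E k A =
    algebraMap (RatFunc k) A (v k ^ (-2 : ℤ)) • (E k A * Kinv k A) := by
  rw [E_mul_Kinv, smul_smul, mul_comm, algebraMap_mul_cancel k A (v_two_mul k), one_smul]

theorem Kinv_mul_F : Kinv k A * F k A =
    algebraMap (RatFunc k) A (v k ^ (2 : ℤ)) • (F k A * Kinv k A) := by
  rw [F_mul_Kinv, smul_smul, algebraMap_mul_cancel k A (v_two_mul k), one_smul]

theorem E_mul_K : E k A * K k A =
    algebraMap (RatFunc k) A (v k ^ (-2 : ℤ)) • (K k A * E k A) := by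
  rw [K_mul_E, smul_smul, mul_comm, algebraMap_mul_cancel k A (v_two_mul k), one_smul]

/-- Lusztig's automorphism `T'_{-1}`:
`E ↦ -K⁻¹F`, `F ↦ -EK`, `K ↦ K⁻¹`. -/
def Tprime : QU k A →ₐ[A] QU k A :=
  lift k A (-(Kinv k A * F k A)) (-(E k A * K k A)) (Kinv k A) (K k A)
    (by
      have h1 : Kinv k A * F k A * (E k A * K k A) = F k A * E k A := by
        rw [E_mul_K, Kinv_mul_F, smul_mul_smul_comm,
          algebraMap_mul_cancel k A (v_two_mul k), one_smul, mul_assoc (F k A),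
          ← mul_assoc (Kinv k A), rel_KinvK, one_mul]
      have h2 : E k A * K k A * (Kinv k A * F k A) = E k A * F k A := by
        rw [mul_assoc (E k A), ← mul_assoc (K k A), rel_KKinv, one_mul]
      rw [neg_mul_neg, neg_mul_neg, h1, h2, ← neg_sub, rel_EF, ← smul_neg, neg_sub])
    (by
      rw [mul_neg, neg_mul, smul_neg, mul_assoc, mul_assoc, F_mul_K, mul_smul_comm,
        mul_smul_comm, ← mul_assoc (Kinv k A) (K k A), rel_KinvK, one_mul])
    (by
      rw [mul_neg, neg_mul, smul_neg, ← mul_assoc, Kinv_mul_E, smul_mul_assoc,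
        smul_mul_assoc, mul_assoc (E k A), rel_KinvK, mul_one])
    (rel_KinvK k A) (rel_KKinv k A)

/-- The comultiplication `Δ(E) = E ⊗ 1 + K ⊗ E`, `Δ(F) = 1 ⊗ F + F ⊗ K⁻¹`, `Δ(K) = K ⊗ K`. -/
def comul : QU k A →ₐ[A] QU k A ⊗[A] QU k A :=
  lift k A (E k A ⊗ₜ 1 + K k A ⊗ₜ E k A) (1 ⊗ₜ F k A + F k A ⊗ₜ Kinv k A)
    (K k A ⊗ₜ K k A) (Kinv k A ⊗ₜ Kinv k A)
    (by
      have h : (K k A * F k A) ⊗ₜ[A] (E k A * Kinv k A) =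
          (F k A * K k A) ⊗ₜ[A] (Kinv k A * E k A) := by
        rw [K_mul_F, E_mul_Kinv, TensorProduct.smul_tmul_smul, mul_comm,
          algebraMap_mul_cancel k A (v_two_mul k), one_smul]
      have h3 : E k A * F k A = F k A * E k A +
          algebraMap (RatFunc k) A (v k - (v k)⁻¹)⁻¹ • (K k A - Kinv k A) := by
        rw [← rel_EF]; abel
      simp only [mul_add, add_mul, Algebra.TensorProduct.tmul_mul_tmul, one_mul, mul_one, h, h3,
        TensorProduct.add_tmul, TensorProduct.tmul_add, TensorProduct.smul_tmul',
        TensorProduct.tmul_smul, TensorProduct.sub_tmul, TensorProduct.tmul_sub, smul_sub]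
      abel)
    (by
      simp only [mul_add, add_mul, Algebra.TensorProduct.tmul_mul_tmul, mul_one, rel_KE,
        rel_KKinv, smul_add, TensorProduct.smul_tmul', TensorProduct.tmul_smul]
      rw [mul_assoc (K k A), rel_KKinv, mul_one])
    (by
      simp only [mul_add, add_mul, Algebra.TensorProduct.tmul_mul_tmul, mul_one, one_mul,
        rel_KF, rel_KKinv, smul_add, TensorProduct.smul_tmul', TensorProduct.tmul_smul])
    (by rw [Algebra.TensorProduct.tmul_mul_tmul, rel_KKinv]; rfl)
    (by rw [Algebra.TensorProduct.tmul_mul_tmul, rel_KinvK]; rfl)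

/-! ### Localization with respect to `F` -/

/-- The multiplicative set generated by `F`. -/
def Fpow : Submonoid (QU k A) := Submonoid.powers (F k A)

/-- Elements killed by a product of operators `x ↦ F x - q x F`. -/
inductive Good : QU k A → Prop
  | zero : Good 0
  | step (q : A) (x : QU k A) (h : Good (F k A * x - q • (x * F k A))) : Good x

variable {k A}

theorem Good.twist (q : A) {x : QU k A} (hx : Good k A x) :
    Good k A (F k A * x - q • (x * F k A)) := by
  induction hx with
  | zero => simpa using Good.zero
  | step q' x h ih =>
    refine Good.step q' _ ?_
    convert ih using 1
    simp only [mul_sub, sub_mul, mul_smul_comm, smul_mul_assoc, smul_sub, mul_assoc,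
      smul_smul, mul_comm q q']
    abel

theorem Good.add {x y : QU k A} (hx : Good k A x) (hy : Good k A y) : Good k A (x + y) := by
  induction hx generalizing y with
  | zero => simpa using hy
  | step q x h ih =>
    refine Good.step q _ ?_
    convert ih (hy.twist q) using 1
    simp only [mul_add, add_mul, smul_add]
    abel

theorem Good.smul (c : A) {x : QU k A} (hx : Good k A x) : Good k A (c • x) := by
  induction hx with
  | zero => simpa using Good.zero
  | step q x h ih =>
    refine Good.step q _ ?_
    convert ih using 1
    simp only [smul_sub, mul_smul_comm, smul_mul_assoc, smul_comm c q]

theorem Good.gen_mul (g : Gen) {x : QU k A} (hx : Good k A x) : Good k A (gen k A g * x) := by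
  have hK : ∀ {x : QU k A}, Good k A x → Good k A (K k A * x) := by
    intro x hx
    induction hx with
    | zero => simpa using Good.zero
    | step q x h ih =>
      refine Good.step (algebraMap (RatFunc k) A (v k ^ (2 : ℤ)) * q) _ ?_
      convert ih.smul (algebraMap (RatFunc k) A (v k ^ (2 : ℤ))) using 1
      rw [← mul_assoc, F_mul_K]
      simp only [mul_sub, smul_sub, mul_smul_comm, smul_mul_assoc, mul_assoc, smul_smul]
  have hK' : ∀ {x : QU k A}, Good k A x → Good k A (Kinv k A * x) := by
    intro x hx
    induction hx with
    | zero => simpa using Good.zero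
    | step q x h ih =>
      refine Good.step (algebraMap (RatFunc k) A (v k ^ (-2 : ℤ)) * q) _ ?_
      convert ih.smul (algebraMap (RatFunc k) A (v k ^ (-2 : ℤ))) using 1
      rw [← mul_assoc, F_mul_Kinv]
      simp only [mul_sub, smul_sub, mul_smul_comm, smul_mul_assoc, mul_assoc, smul_smul]
  cases g with
  | K => exact hK hx
  | Kinv => exact hK' hx
  | F =>
    induction hx with
    | zero => simpa using Good.zero
    | step q x h ih =>
      refine Good.step q _ ?_
      convert ih using 1
      simp only [mul_sub, mul_smul_comm, mul_assoc]
  | E =>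
    induction hx with
    | zero => simpa using Good.zero
    | step q x h ih =>
      refine Good.step q _ ?_
      have hx : Good k A x := Good.step q x h
      convert (ih.add ((hK hx).smul (-algebraMap (RatFunc k) A (v k - (v k)⁻¹)⁻¹))).add
        ((hK' hx).smul (algebraMap (RatFunc k) A (v k - (v k)⁻¹)⁻¹)) using 1
      have h3 : F k A * E k A = E k A * F k A -
          algebraMap (RatFunc k) A (v k - (v k)⁻¹)⁻¹ • (K k A - Kinv k A) := by
        rw [← rel_EF]; abel
      rw [← mul_assoc, h3]
      simp only [mul_sub, sub_mul, mul_smul_comm, smul_mul_assoc, mul_assoc, smul_sub, neg_smul]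
      abel

theorem good (x : QU k A) : Good k A x := by
  obtain ⟨a, rfl⟩ := RingQuot.mkAlgHom_surjective A (Rel k A) x
  let π : FreeAlgebra A Gen →ₐ[A] QU k A := RingQuot.mkAlgHom A (Rel k A)
  change Good k A (π a)
  have key : ∀ y : QU k A, Good k A y → Good k A (π a * y) := by
    induction a using FreeAlgebra.induction with
    | grade0 r =>
      intro y hy
      rw [AlgHom.commutes]
      convert hy.smul r using 1
      exact (Algebra.smul_def r y).symm
    | grade1 g => exact fun y hy => hy.gen_mul g
    | mul a b ha hb =>
      intro y hy
      rw [map_mul]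
      have := ha _ (hb _ hy)
      rwa [← mul_assoc] at this
    | add a b ha hb =>
      intro y hy
      rw [map_add]
      have := (ha _ hy).add (hb _ hy)
      rwa [← add_mul] at this
  have h1 : Good k A (1 : QU k A) := Good.step 1 _ (by simpa using Good.zero)
  have := key 1 h1
  rwa [mul_one] at this

theorem cancel_F (x : QU k A) (h : x * F k A = 0) : ∃ l : ℕ, F k A ^ l * x = 0 := by
  have hx := good x
  induction hx with
  | zero => exact ⟨0, by simp⟩
  | step q x _ ih =>
    obtain ⟨l, hl⟩ := ih (by rw [h, smul_zero, sub_zero, mul_assoc, h, mul_zero])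
    refine ⟨l + 1, ?_⟩
    rw [h, smul_zero, sub_zero] at hl
    rw [pow_succ, mul_assoc, hl]

theorem cancel_F_pow (j : ℕ) (x : QU k A) (h : x * F k A ^ j = 0) :
    ∃ l : ℕ, F k A ^ l * x = 0 := by
  induction j generalizing x with
  | zero => exact ⟨0, by simpa using h⟩
  | succ j ih =>
    rw [pow_succ, ← mul_assoc] at h
    obtain ⟨l, hl⟩ := cancel_F _ h
    rw [← mul_assoc] at hl
    obtain ⟨l', hl'⟩ := ih _ hl
    exact ⟨l' + l, by rw [pow_add, mul_assoc, hl']⟩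

theorem ore_F (x : QU k A) : ∃ (l : ℕ) (y : QU k A), F k A ^ l * x = y * F k A := by
  have hx := good x
  induction hx with
  | zero => exact ⟨0, 0, by simp⟩
  | step q x _ ih =>
    obtain ⟨l, y, hl⟩ := ih
    refine ⟨l + 1, y + q • (F k A ^ l * x), ?_⟩
    rw [mul_sub, sub_eq_iff_eq_add] at hl
    rw [pow_succ, mul_assoc, hl, add_mul, mul_smul_comm, smul_mul_assoc, mul_assoc]

theorem ore_F_pow (j : ℕ) (x : QU k A) :
    ∃ (l : ℕ) (y : QU k A), F k A ^ l * x = y * F k A ^ j := by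
  induction j generalizing x with
  | zero => exact ⟨0, x, by simp⟩
  | succ j ih =>
    obtain ⟨l, y, h⟩ := ih x
    obtain ⟨l', y', h'⟩ := ore_F y
    exact ⟨l' + l, y', by
      rw [pow_add, mul_assoc, h, ← mul_assoc, h', mul_assoc, ← pow_succ']⟩

/-- The powers of `F` form a (left) Ore set. -/
instance : OreLocalization.OreSet (Fpow k A) :=
  Classical.choice (OreLocalization.nonempty_oreSet_iff.2 ⟨by
    rintro r₁ r₂ ⟨_, j, rfl⟩ h
    obtain ⟨l, hl⟩ := cancel_F_pow j (r₁ - r₂) (by rw [sub_mul]; exact sub_eq_zero.2 h)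
    exact ⟨⟨F k A ^ l, l, rfl⟩, sub_eq_zero.1 (by rw [← mul_sub]; exact hl)⟩, by
    rintro r ⟨_, j, rfl⟩
    obtain ⟨l, y, h⟩ := ore_F_pow j r
    exact ⟨y, ⟨F k A ^ l, l, rfl⟩, h⟩⟩)

variable (k A)

section Localization

variable (V : Type*) [AddCommGroup V] [Module (QU k A) V]

/-- The localization `V_F` of a module with respect to the powers of `F`. -/
abbrev LocF : Type _ := OreLocalization (Fpow k A) V

/-- The canonical map `ι : V → V_F`. -/
def toLocF : V →ₗ[QU k A] LocF k A V where
  toFun x := x /ₒ (1 : Fpow k A)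
  map_add' _ _ := OreLocalization.add_oreDiv.symm
  map_smul' a x := by
    rw [RingHom.id_apply, OreLocalization.smul_oreDiv_one]

/-- `V_π = V_F / ι V`. -/
abbrev LocPi : Type _ := LocF k A V ⧸ LinearMap.range (toLocF k A V)

variable {V} in
/-- The class of `F⁻¹ x` in `V_π`. -/
def FinvPi (x : V) : LocPi k A V :=
  Submodule.Quotient.mk (x /ₒ (⟨F k A, Submonoid.mem_powers _⟩ : Fpow k A))

end Localization

/-! ### Representations -/

/-- The representation afforded by a `QU`-module. -/
abbrev modRep (V : Type*) [AddCommGroup V] [Module A V] [Module (QU k A) V]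
    [IsScalarTower A (QU k A) V] : QU k A →ₐ[A] Module.End A V :=
  Algebra.lsmul A A V

variable {k A} in
/-- The tensor product of two representations, through the comultiplication. -/
def tensorRep {V W : Type*} [AddCommGroup V] [Module A V] [AddCommGroup W] [Module A W]
    (ρ : QU k A →ₐ[A] Module.End A V) (σ : QU k A →ₐ[A] Module.End A W) :
    QU k A →ₐ[A] Module.End A (V ⊗[A] W) :=
  Module.endTensorEndAlgHom.comp ((Algebra.TensorProduct.map ρ σ).comp (comul k A))

variable {k A} in
/-- `x` is a highest weight vector of weight `χ`: `x ≠ 0`, `E x = 0`, `K x = χ x`. -/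
def IsHighestWeightVector {V : Type*} [AddCommGroup V] [Module A V]
    (ρ : QU k A →ₐ[A] Module.End A V) (χ : A) (x : V) : Prop :=
  x ≠ 0 ∧ ρ (E k A) x = 0 ∧ ρ (K k A) x = χ • x

variable {k A} in
/-- `x` is a lowest weight vector of weight `χ`: `x ≠ 0`, `F x = 0`, `K x = χ x`. -/
def IsLowestWeightVector {V : Type*} [AddCommGroup V] [Module A V]
    (ρ : QU k A →ₐ[A] Module.End A V) (χ : A) (x : V) : Prop :=
  x ≠ 0 ∧ ρ (F k A) x = 0 ∧ ρ (K k A) x = χ • x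

variable {k A} in
/-- `F^{(-j)} x := T'_{-1}(F^{(j)}) x`. -/
def Fneg {V : Type*} [AddCommGroup V] [Module A V]
    (ρ : QU k A →ₐ[A] Module.End A V) (j : ℕ) (x : V) : V :=
  ρ (Tprime k A (Fdiv k A j)) x

variable {k A} in
/-- Lusztig's map
`L(x ⊗ y) = ∑_j (-1)^j v^{-j(j-1)/2} {j} F^{(j)} x ⊗ E^{(j)} y`
(the sum is finite if `E` is locally nilpotent on the second factor). -/
def L {V W : Type*} [AddCommGroup V] [Module A V] [AddCommGroup W] [Module A W]
    (ρ : QU k A →ₐ[A] Module.End A V) (σ : QU k A →ₐ[A] Module.End A W)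
    (z : V ⊗[A] W) : V ⊗[A] W :=
  ∑ᶠ j : ℕ, algebraMap (RatFunc k) A
      ((-1) ^ j * v k ^ (-((j * (j - 1) / 2 : ℕ) : ℤ)) * qbrace k j) •
    TensorProduct.map (ρ (Fdiv k A j)) (σ (Ediv k A j)) z

variable {k A} in
/-- The formula `L⁻¹(x ⊗ y) = ∑_j v^{j(j-1)/2} {j} F^{(j)} x ⊗ E^{(j)} y`. -/
def Linv {V W : Type*} [AddCommGroup V] [Module A V] [AddCommGroup W] [Module A W]
    (ρ : QU k A →ₐ[A] Module.End A V) (σ : QU k A →ₐ[A] Module.End A W)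
    (z : V ⊗[A] W) : V ⊗[A] W :=
  ∑ᶠ j : ℕ, algebraMap (RatFunc k) A (v k ^ ((j * (j - 1) / 2 : ℕ) : ℤ) * qbrace k j) •
    TensorProduct.map (ρ (Fdiv k A j)) (σ (Ediv k A j)) z

/-! ### Verma modules -/

/-- The left ideal generated by `E` and `K - c`. -/
def vermaIdeal (c : A) : Submodule (QU k A) (QU k A) :=
  Submodule.span (QU k A) {E k A, K k A - algebraMap A (QU k A) c}

/-- The Verma module of highest weight `c`: the module induced from the one-dimensional
representation `E ↦ 0`, `K ↦ c` of the subalgebra generated by `E` and `K^{±1}`. -/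
abbrev Verma (c : A) : Type _ := QU k A ⧸ vermaIdeal k A c

/-- The canonical generator `1 ⊗ 1` of a Verma module. -/
def vermaGen (c : A) : Verma k A c := Submodule.Quotient.mk 1

/-! ### The finite dimensional modules `F_n` -/

section FiniteDimensional

variable (n : ℕ)

/-- `E u_j = [n+1-j] u_{j-1}` on coordinates. -/
def finE : Module.End A (Fin (n + 1) → A) where
  toFun f i := if h : (i : ℕ) < n then
    algebraMap (RatFunc k) A (qint k ((n : ℤ) - (i : ℕ))) * f ⟨i + 1, by omega⟩ else 0
  map_add' f g := by
    funext i
    by_cases h : (i : ℕ) < n <;> simp [h, mul_add]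
  map_smul' c f := by
    funext i
    by_cases h : (i : ℕ) < n <;> simp [h, mul_left_comm]

/-- `F u_j = [j+1] u_{j+1}` on coordinates. -/
def finF : Module.End A (Fin (n + 1) → A) where
  toFun f i := if h : 0 < (i : ℕ) then
    algebraMap (RatFunc k) A (qint k (i : ℕ)) * f ⟨i - 1, by omega⟩ else 0
  map_add' f g := by
    funext i
    simp only [Pi.add_apply]
    split_ifs <;> ring
  map_smul' c f := by
    funext i
    simp only [Pi.smul_apply, smul_eq_mul, RingHom.id_apply]
    split_ifs <;> ring

/-- `K^{ε} u_j = v^{ε(n-2j)} u_j` on coordinates. -/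
def finK (ε : ℤ) : Module.End A (Fin (n + 1) → A) where
  toFun f i := algebraMap (RatFunc k) A (v k ^ (ε * ((n : ℤ) - 2 * (i : ℕ)))) * f i
  map_add' f g := by
    funext i
    simp [mul_add]
  map_smul' c f := by
    funext i
    simp [mul_left_comm]

theorem qint_zero : qint k 0 = 0 := by simp [qint]

theorem v_sub_ne_zero : v k - (v k)⁻¹ ≠ 0 := by
  intro h
  have hv := v_ne_zero k
  have h2 : v k * v k = 1 := by
    rw [sub_eq_zero] at h
    nth_rewrite 1 [h]
    exact inv_mul_cancel₀ hv
  have h3 : (algebraMap (Polynomial k) (RatFunc k)) (Polynomial.X * Polynomial.X) =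
      algebraMap (Polynomial k) (RatFunc k) 1 := by
    simpa [v] using h2
  have h4 := RatFunc.algebraMap_injective k h3
  have h5 := congrArg Polynomial.natDegree h4
  simp at h5

theorem qint_relation (a b : ℤ) :
    qint k (a + 1) * qint k b - qint k (b + 1) * qint k a =
      (v k - (v k)⁻¹)⁻¹ * (v k ^ (b - a) - v k ^ (-(b - a))) := by
  have hv := v_ne_zero k
  have hd := v_sub_ne_zero k
  have ha := zpow_ne_zero a hv
  have hb := zpow_ne_zero b hv
  have h1 : qint k (a + 1) * qint k b - qint k (b + 1) * qint k a =
      ((v k ^ (a + 1) - v k ^ (-(a + 1))) * (v k ^ b - v k ^ (-b)) -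
        (v k ^ (b + 1) - v k ^ (-(b + 1))) * (v k ^ a - v k ^ (-a))) /
        ((v k - (v k)⁻¹) * (v k - (v k)⁻¹)) := by
    simp only [qint]
    rw [div_mul_div_comm, div_mul_div_comm, ← sub_div]
  have h2 : (v k ^ (a + 1) - v k ^ (-(a + 1))) * (v k ^ b - v k ^ (-b)) -
        (v k ^ (b + 1) - v k ^ (-(b + 1))) * (v k ^ a - v k ^ (-a)) =
      (v k - (v k)⁻¹) * (v k ^ (b - a) - v k ^ (-(b - a))) := by
    simp only [zpow_neg, zpow_sub₀ hv, zpow_add₀ hv, zpow_one]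
    field_simp
    ring
  rw [h1, h2, mul_div_mul_left _ _ hd, inv_mul_eq_div]

/-- The simple module `F_n` of highest weight `v^n`, with basis `u_0, …, u_n`. -/
def finRep : QU k A →ₐ[A] Module.End A (Fin (n + 1) → A) :=
  lift k A (finE k A n) (finF k A n) (finK k A n 1) (finK k A n (-1))
    (by
      apply LinearMap.ext; intro f; funext i
      obtain ⟨i, hi⟩ := i
      have key := congrArg (algebraMap (RatFunc k) A) (qint_relation k i ((n : ℤ) - i))
      simp only [map_sub, map_mul] at key
      have e1 : (algebraMap (RatFunc k) A) (v k ^ ((n : ℤ) - i - i)) =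
          (algebraMap (RatFunc k) A) (v k ^ (1 * ((n : ℤ) - 2 * i))) := by
        congr 2; ring
      have e2 : (algebraMap (RatFunc k) A) (v k ^ (-((n : ℤ) - i - i))) =
          (algebraMap (RatFunc k) A) (v k ^ (-1 * ((n : ℤ) - 2 * i))) := by
        congr 2; ring
      rw [e1, e2] at key
      have hL : (finE k A n * finF k A n) f ⟨i, hi⟩ =
          algebraMap (RatFunc k) A (qint k ((i : ℤ) + 1)) *
            algebraMap (RatFunc k) A (qint k ((n : ℤ) - i)) * f ⟨i, hi⟩ := by
        by_cases h : i < n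
        · simp only [finE, finF, Module.End.mul_apply, LinearMap.coe_mk, AddHom.coe_mk, h,
            dif_pos, Nat.succ_pos, Nat.add_sub_cancel, Nat.cast_add, Nat.cast_one]
          ring
        · have : (n : ℤ) - i = 0 := by omega
          simp [finE, h, this, qint_zero]
      have hR : (finF k A n * finE k A n) f ⟨i, hi⟩ =
          algebraMap (RatFunc k) A (qint k ((n : ℤ) - i + 1)) *
            algebraMap (RatFunc k) A (qint k i) * f ⟨i, hi⟩ := by
        by_cases h : 0 < i
        · obtain ⟨j, rfl⟩ : ∃ j, i = j + 1 := ⟨i - 1, by omega⟩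
          have hj : j < n := by omega
          have : (n : ℤ) - (j + 1 : ℕ) + 1 = n - j := by push_cast; ring
          simp only [finE, finF, Module.End.mul_apply, LinearMap.coe_mk, AddHom.coe_mk, h,
            dif_pos, Nat.add_sub_cancel, hj, this]
          ring
        · have : i = 0 := by omega
          subst this
          simp [finF, qint_zero]
      rw [LinearMap.sub_apply, Pi.sub_apply, hL, hR, ← sub_mul, key]
      simp only [finK, LinearMap.smul_apply, LinearMap.sub_apply, Pi.smul_apply, Pi.sub_apply,
        LinearMap.coe_mk, AddHom.coe_mk, smul_eq_mul]
      ring)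
    (by
      apply LinearMap.ext; intro f; funext i
      obtain ⟨i, hi⟩ := i
      by_cases h : i < n
      · simp only [finE, finK, Module.End.mul_apply, LinearMap.coe_mk, AddHom.coe_mk, h,
          dif_pos, LinearMap.smul_apply, Pi.smul_apply, smul_eq_mul]
        have : v k ^ (2 : ℤ) = v k ^ (1 * ((n : ℤ) - 2 * i)) *
            v k ^ (-1 * ((n : ℤ) - 2 * ((i + 1 : ℕ) : ℤ))) := by
          rw [← zpow_add₀ (v_ne_zero k)]; congr 1; push_cast; ring
        rw [this, map_mul]
        ring
      · simp [finE, finK, h])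
    (by
      apply LinearMap.ext; intro f; funext i
      obtain ⟨i, hi⟩ := i
      by_cases h : 0 < i
      · obtain ⟨j, rfl⟩ : ∃ j, i = j + 1 := ⟨i - 1, by omega⟩
        simp only [finF, finK, Module.End.mul_apply, LinearMap.coe_mk, AddHom.coe_mk, h,
          dif_pos, LinearMap.smul_apply, Pi.smul_apply, smul_eq_mul, Nat.add_sub_cancel]
        have : v k ^ (-2 : ℤ) = v k ^ (1 * ((n : ℤ) - 2 * ((j + 1 : ℕ) : ℤ))) *
            v k ^ (-1 * ((n : ℤ) - 2 * (j : ℤ))) := by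
          rw [← zpow_add₀ (v_ne_zero k)]; congr 1; push_cast; ring
        rw [this, map_mul]
        ring
      · simp only [finF, finK, Module.End.mul_apply, LinearMap.coe_mk, AddHom.coe_mk, h,
          dif_neg, not_false_eq_true, LinearMap.smul_apply, Pi.smul_apply, smul_zero, mul_zero])
    (by
      apply LinearMap.ext; intro f; funext i
      simp only [finK, Module.End.mul_apply, LinearMap.coe_mk, AddHom.coe_mk, Module.End.one_apply]
      rw [← mul_assoc, ← map_mul, ← zpow_add₀ (v_ne_zero k)]
      simp)
    (by
      apply LinearMap.ext; intro f; funext i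
      simp only [finK, Module.End.mul_apply, LinearMap.coe_mk, AddHom.coe_mk, Module.End.one_apply]
      rw [← mul_assoc, ← map_mul, ← zpow_add₀ (v_ne_zero k)]
      simp)

/-- `u_j^{(n)} = F^{(j)} u^{(n)}`, where `u^{(n)}` is the highest weight vector. -/
def u (j : ℕ) : Fin (n + 1) → A := finRep k A n (Fdiv k A j) (Pi.single 0 1)

end FiniteDimensional

end Algebra

/-! ### The ring `R = k(v)[[T-1]]` and the modules over it -/

section PowerSeries

variable (k : Type*) [Field k]

/-- `R = k(v)[[T-1]]`; the variable of the power series ring is `T - 1`. -/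
abbrev R : Type _ := PowerSeries (RatFunc k)

/-- `T = 1 + (T - 1)`, a unit of `R`. -/
def T : (R k)ˣ where
  val := 1 + PowerSeries.X
  inv := (1 + PowerSeries.X)⁻¹
  val_inv := PowerSeries.mul_inv_cancel _ (by simp)
  inv_val := PowerSeries.inv_mul_cancel _ (by simp)

variable {k} in
/-- An element of `k(v)` as an element of `R`. -/
abbrev toR (a : RatFunc k) : R k := algebraMap (RatFunc k) (R k) a

variable {k} in
/-- `[t; r] = (v^r t - v^{-r} t⁻¹) / (v - v⁻¹)` for a unit `t` of `R` (`t = T` or `t = T⁻¹`). -/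
def Tint (t : (R k)ˣ) (r : ℤ) : R k :=
  toR (v k - (v k)⁻¹)⁻¹ * (toR (v k ^ r) * (t : R k) - toR (v k ^ (-r)) * ((t⁻¹ : (R k)ˣ) : R k))

variable {k} in
/-- `[t; r]_{(j)} = [t; r] [t; r-1] ⋯ [t; r-j+1]`. -/
def Tfall (t : (R k)ˣ) (r : ℤ) (j : ℕ) : R k := ∏ i ∈ Finset.range j, Tint t (r - i)

/-- The weight `T v^a`. -/
def wt (a : ℤ) : R k := (T k : R k) * toR (v k ^ a)

/-- `M`, the Verma module of highest weight `T v⁻¹`. -/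
abbrev M : Type _ := Verma k (R k) (wt k (-1))

/-- `w_{0,-1} = 1 ⊗ 1 ∈ M`. -/
def w0 : M k := vermaGen k (R k) (wt k (-1))

/-- `M_π = M_F / ι M`. -/
abbrev Mpi : Type _ := LocPi k (R k) (M k)

/-- The action on `M`. -/
abbrev rhoM : QU k (R k) →ₐ[R k] Module.End (R k) (M k) := modRep k (R k) (M k)

/-- The action on `M_π`. -/
abbrev rhoMpi : QU k (R k) →ₐ[R k] Module.End (R k) (Mpi k) := modRep k (R k) (Mpi k)

/-- `F_n` with scalars extended to `R`. -/
abbrev Fn (n : ℕ) : Type _ := Fin (n + 1) → R k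

/-- The action on `F_n`. -/
abbrev rhoFn (n : ℕ) : QU k (R k) →ₐ[R k] Module.End (R k) (Fn k n) := finRep k (R k) n

/-- The basis vectors `u_j^{(n)}`. -/
abbrev uR (n j : ℕ) : Fn k n := u k (R k) n j

/-- `w_{r,r-1}`, with `r = n - 2p`. -/
def wPlus (n p : ℕ) : M k ⊗[R k] Fn k n :=
  ∑ j ∈ Finset.range (p + 1),
    (toR (qfall k ((n : ℤ) - p + j) j * v k ^ (-(j : ℤ) ^ 2)) *
      (((T k ^ (-(j : ℤ)) : (R k)ˣ) : R k) * Tfall (T k)⁻¹ j j)⁻¹) •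
      (rhoM k (Fdiv k (R k) j) (w0 k) ⊗ₜ[R k] uR k n (p - j))

/-- `w_{-r,-r-1}`, with `r = n - 2p`. -/
def wMinus (n p : ℕ) : M k ⊗[R k] Fn k n :=
  ∑ j ∈ Finset.range (n - p + 1),
    (toR (qfall k ((p : ℤ) + j) j * v k ^ (-(j : ℤ) ^ 2)) *
      (((T k ^ (-(j : ℤ)) : (R k)ˣ) : R k) * Tfall (T k)⁻¹ j j)⁻¹) •
      (rhoM k (Fdiv k (R k) j) (w0 k) ⊗ₜ[R k] uR k n (n - p - j))

variable {k}

/-- `m_{r,r+1}`, with `r = n - 2p`, built from a lowest weight vector `m = m_{0,1}` of `M_π`. -/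
def mPlus (n p : ℕ) (r : ℤ) (m : Mpi k) : Mpi k ⊗[R k] Fn k n :=
  ∑ j ∈ Finset.range (n - p + 1),
    ((-1) ^ j * toR (qfall k ((p : ℤ) + j) j * v k ^ (-(j : ℤ) * (-r + 2 * j + 1))) *
      (((T k ^ j : (R k)ˣ) : R k) * Tfall (T k) j j)⁻¹) •
      (Fneg (rhoMpi k) j m ⊗ₜ[R k] uR k n (p + j))

/-- `m_{-r,-r+1}`, with `r = n - 2p`, built from a lowest weight vector `m = m_{0,1}` of `M_π`. -/
def mMinus (n p : ℕ) (r : ℤ) (m : Mpi k) : Mpi k ⊗[R k] Fn k n :=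
  ∑ j ∈ Finset.range (p + 1),
    ((-1) ^ j * toR (qfall k ((n : ℤ) - p + j) j * v k ^ (-(j : ℤ) * (r + 2 * j + 1))) *
      (((T k ^ j : (R k)ˣ) : R k) * Tfall (T k) j j)⁻¹) •
      (Fneg (rhoMpi k) j m ⊗ₜ[R k] uR k n (n - p + j))

end PowerSeries

end QSL2

end

namespace QSL2

/-! ### Identities for q-numbers in k(v). -/

section Calculus

variable (k : Type*) [Field k]

/-! The extremal vectors come from two formulas valid in any representation over R. If Ew = 0 and w
has weight Tv^a, then E F^{(j+1)}w = [T;a-j] F^{(j)}w (`rep_E_Fdiv_succ`); if Fm = 0 and m has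
weight Tv, then F F^{(-j-1)}m = Tv^{2j+1}[T;j+1] F^{(-j)}m (`rep_F_Fneg_succ`). Applying Δ(E) or
Δ(F) to a sum of c_j x_j ⊗ u_{p∓j} then gives two contributions to each pure tensor, and they cancel
because the c_j obey a first-order recursion (`highCoeff_succ`, `lowCoeff_succ`). The denominators
are units of R, since [t;m] has constant term [m] and v is not a root of unity. The sum is nonzero
because c_0 = 1 and the other summands lie over other basis vectors of F_n. Replacing p by n - p
changes r into -r, so one statement covers both vectors of each kind.

On M_π ⊗ F_n the operator X = F ⊗ E is nilpotent. The formulas for L and L⁻¹ are two v-exponential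
series in (v - v⁻¹)X, and these are inverse power series (`sum_antidiagonal_qexp`). Evaluating L⁻¹
on a lowest weight vector and collecting the terms in F^{(-s)}m ⊗ u_{p+s} leaves a scalar sum in
k(v) (`sum_Linv_coeff`), which is a q-Vandermonde sum (`sum_qbinom_mul_prod`) at x = v^{-2(p+s+1)}.

That w and the class of F⁻¹w do not vanish is read off from an explicit action on sequences ℕ → R in
which F is the shift. The sequences need not be finitely supported: only a target of an equivariant
map from M is needed, with F injective and the image of w outside the image of F. -/

theorem v_pow_ne_one {m : ℕ} (hm : m ≠ 0) : v k ^ m ≠ 1 := by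
  intro h
  have h3 : (algebraMap (Polynomial k) (RatFunc k)) (Polynomial.X ^ m) =
      algebraMap (Polynomial k) (RatFunc k) 1 := by
    simpa [v] using h
  have h5 := congrArg Polynomial.natDegree (RatFunc.algebraMap_injective k h3)
  simp [hm] at h5

theorem v_zpow_ne_one {m : ℤ} (hm : m ≠ 0) : v k ^ m ≠ 1 := by
  obtain ⟨n, rfl | rfl⟩ := m.eq_nat_or_neg
  · rw [zpow_natCast]
    exact v_pow_ne_one k (by simpa using hm)
  · rw [zpow_neg, zpow_natCast, ne_eq, inv_eq_one]
    exact v_pow_ne_one k (by simpa using hm)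

/-- Otherwise v^{2m} = 1, but v is not a root of unity. The divisions by q-factorials, and the
invertibility of [T;m] in R, rest on this. -/
theorem qint_ne_zero {m : ℤ} (hm : m ≠ 0) : qint k m ≠ 0 := by
  refine div_ne_zero (fun h => ?_) (v_sub_ne_zero k)
  refine v_zpow_ne_one k (m := m + m) (by omega) ?_
  rw [sub_eq_zero] at h
  rw [zpow_add₀ (v_ne_zero k)]
  nth_rewrite 2 [h]
  rw [← zpow_add₀ (v_ne_zero k), add_neg_cancel, zpow_zero]

theorem sub_inv_mul_qint (m : ℤ) : (v k - (v k)⁻¹) * qint k m = v k ^ m - v k ^ (-m) :=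
  mul_div_cancel₀ _ (v_sub_ne_zero k)

/-- The mixed term v^{b-a} is inserted and removed. This addition law drives both the q-Pascal rule
and the inversion of the v-exponential. -/
theorem qint_add (a b : ℤ) : qint k (a + b) = v k ^ b * qint k a + v k ^ (-a) * qint k b := by
  refine mul_left_cancel₀ (v_sub_ne_zero k) ?_
  rw [mul_add, mul_left_comm, mul_left_comm _ (v k ^ (-a)), sub_inv_mul_qint, sub_inv_mul_qint,
    sub_inv_mul_qint, mul_sub, mul_sub, ← zpow_add₀ (v_ne_zero k), ← zpow_add₀ (v_ne_zero k),
    ← zpow_add₀ (v_ne_zero k), ← zpow_add₀ (v_ne_zero k), neg_add, add_comm a b, add_comm (-a) (-b),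
    add_comm b (-a), add_comm (-b) (-a)]
  abel

theorem qint_one : qint k 1 = 1 := by
  simp [qint, div_self (v_sub_ne_zero k)]

theorem qfall_zero (m : ℤ) : qfall k m 0 = 1 := rfl

theorem qfall_succ (m : ℤ) (j : ℕ) : qfall k m (j + 1) = qfall k m j * qint k (m - j) :=
  Finset.prod_range_succ _ _

theorem qfall_succ_left (m : ℤ) (j : ℕ) :
    qfall k (m + 1) (j + 1) = qint k (m + 1) * qfall k m j := by
  rw [qfall, Finset.prod_range_succ', mul_comm]
  congr 1
  · simp
  · exact Finset.prod_congr rfl fun i _ => by congr 1; push_cast; ring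

theorem qfall_add (m : ℤ) (i j : ℕ) : qfall k m (i + j) = qfall k m i * qfall k (m - i) j := by
  rw [qfall, Finset.prod_range_add]
  congr 1
  exact Finset.prod_congr rfl fun i _ => by congr 1; push_cast; ring

theorem qfall_eq_zero {N i : ℕ} (h : N < i) : qfall k N i = 0 :=
  Finset.prod_eq_zero (Finset.mem_range.2 h) (by rw [sub_self, qint_zero])

theorem qfact_zero : qfact k 0 = 1 := rfl

theorem qfact_succ (j : ℕ) : qfact k (j + 1) = qint k (j + 1) * qfact k j := by
  rw [qfact, Nat.cast_succ, qfall_succ_left, qfact]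

theorem qfact_ne_zero (j : ℕ) : qfact k j ≠ 0 := by
  induction j with
  | zero => exact one_ne_zero
  | succ j ih =>
    rw [qfact_succ]
    exact mul_ne_zero (qint_ne_zero k (by omega)) ih

theorem qbrace_eq (j : ℕ) : qbrace k j = (v k - (v k)⁻¹) ^ j * qfact k j := by
  induction j with
  | zero => simp [qbrace, qfact_zero]
  | succ j ih =>
    rw [qbrace, Finset.prod_Icc_succ_top (by omega), ← qbrace, ih, qfact_succ, ← sub_inv_mul_qint]
    push_cast
    ring

/-- The exponent `j (j - 1) / 2` of the quasi-`R`-matrix. -/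
theorem succ_choose_two (j : ℕ) :
    (((j + 1) * (j + 1 - 1) / 2 : ℕ) : ℤ) = ((j * (j - 1) / 2 : ℕ) : ℤ) + j := by
  have := Nat.triangle_succ j
  omega

/-- The coefficients of the `v`-exponential and of its inverse. -/
theorem sum_antidiagonal_qexp (N : ℕ) :
    ∑ x ∈ Finset.HasAntidiagonal.antidiagonal (N + 1),
      ((-1) ^ x.1 * v k ^ (-((x.1 * (x.1 - 1) / 2 : ℕ) : ℤ)) * (qfact k x.1)⁻¹) *
        (v k ^ ((x.2 * (x.2 - 1) / 2 : ℕ) : ℤ) * (qfact k x.2)⁻¹) = 0 := by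
  set f : ℕ → RatFunc k := fun a =>
    (-1) ^ a * v k ^ (-((a * (a - 1) / 2 : ℕ) : ℤ)) * (qfact k a)⁻¹ with hf
  set g : ℕ → RatFunc k := fun b => v k ^ ((b * (b - 1) / 2 : ℕ) : ℤ) * (qfact k b)⁻¹ with hg
  change ∑ x ∈ Finset.HasAntidiagonal.antidiagonal (N + 1), f x.1 * g x.2 = 0
  have hf' : ∀ a : ℕ, qint k ((a : ℤ) + 1) * f (a + 1) = -(v k ^ (-(a : ℤ)) * f a) := by
    intro a
    have h1 := qint_ne_zero k (m := (a : ℤ) + 1) (by omega)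
    have h2 := qfact_ne_zero k a
    simp only [hf]
    rw [succ_choose_two, neg_add, zpow_add₀ (v_ne_zero k), qfact_succ, pow_succ]
    field_simp
  have hg' : ∀ b : ℕ, qint k ((b : ℤ) + 1) * g (b + 1) = v k ^ (b : ℤ) * g b := by
    intro b
    have h1 := qint_ne_zero k (m := (b : ℤ) + 1) (by omega)
    have h2 := qfact_ne_zero k b
    simp only [hg]
    rw [succ_choose_two, zpow_add₀ (v_ne_zero k), qfact_succ]
    field_simp
  -- Multiply by [N+1] = [a+b] and split it by `qint_add`. Each half absorbs [a] or [b] through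
  -- `hf'` or `hg'` and becomes a sum over the antidiagonal of N; the two sums are opposite.
  refine (mul_eq_zero.1 ?_).resolve_left (qint_ne_zero k (m := (N : ℤ) + 1) (by omega))
  have h : qint k ((N : ℤ) + 1) * ∑ x ∈ Finset.HasAntidiagonal.antidiagonal (N + 1), f x.1 * g x.2 =
      ∑ x ∈ Finset.HasAntidiagonal.antidiagonal (N + 1), v k ^ (x.2 : ℤ) * (qint k x.1 * f x.1) * g x.2 +
      ∑ x ∈ Finset.HasAntidiagonal.antidiagonal (N + 1), v k ^ (-(x.1 : ℤ)) * f x.1 * (qint k x.2 * g x.2) := by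
    rw [Finset.mul_sum, ← Finset.sum_add_distrib]
    refine Finset.sum_congr rfl fun x hx => ?_
    have : ((N : ℤ) + 1) = x.1 + x.2 := by exact_mod_cast (Finset.HasAntidiagonal.mem_antidiagonal.1 hx).symm
    rw [this, qint_add]
    ring
  rw [h, Finset.Nat.sum_antidiagonal_succ, Finset.Nat.sum_antidiagonal_succ']
  simp only [Nat.cast_zero, qint_zero, zero_mul, mul_zero, Nat.cast_succ, hf', hg', zero_add]
  rw [← Finset.sum_add_distrib]
  exact Finset.sum_eq_zero fun x _ => by ring

/-- The q-Pascal rule, obtained by splitting [N+1] as [(i+1) + (N-i)]. -/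
theorem qbinom_pascal (N i : ℕ) :
    qfall k ((N : ℤ) + 1) (i + 1) * (qfact k (i + 1))⁻¹ =
      v k ^ (-((i : ℤ) + 1)) * (qfall k N (i + 1) * (qfact k (i + 1))⁻¹) +
        v k ^ ((N : ℤ) - i) * (qfall k N i * (qfact k i)⁻¹) := by
  have h1 := qint_ne_zero k (m := (i : ℤ) + 1) (by omega)
  have h2 := qfact_ne_zero k i
  have h3 := qint_add k ((i : ℤ) + 1) ((N : ℤ) - i)
  rw [show ((i : ℤ) + 1) + ((N : ℤ) - i) = N + 1 by ring] at h3
  rw [qfall_succ_left, qfall_succ, qfact_succ, h3]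
  field_simp
  ring

/-- A form of the `q`-Vandermonde identity. -/
theorem sum_qbinom_mul_prod (N : ℕ) (x : RatFunc k) :
    ∑ i ∈ Finset.range (N + 1), (-1) ^ i * v k ^ ((i : ℤ) * ((N : ℤ) - 1)) *
      (qfall k N i * (qfact k i)⁻¹) *
      ∏ l ∈ Finset.range i, (1 - x * v k ^ (-2 * (l : ℤ))) = x ^ N := by
  induction N generalizing x with
  | zero => simp [qfall_zero, qfact_zero]
  | succ N ih =>
    have hv := v_ne_zero k
    -- Pascal's rule splits the sum for N+1 into the sum for N at x and, once the factor l = 0 has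
    -- been taken out of the product, the sum for N at x v^{-2}.
    have key := ih (x * v k ^ (-2 : ℤ))
    have h0 := ih x
    rw [Finset.sum_range_succ']
    have step : ∀ i ∈ Finset.range (N + 1),
        (-1) ^ (i + 1) * v k ^ (((i + 1 : ℕ) : ℤ) * (((N + 1 : ℕ) : ℤ) - 1)) *
          (qfall k (N + 1 : ℕ) (i + 1) * (qfact k (i + 1))⁻¹) *
          ∏ l ∈ Finset.range (i + 1), (1 - x * v k ^ (-2 * (l : ℤ))) =
        (-1) ^ (i + 1) * v k ^ (((i + 1 : ℕ) : ℤ) * ((N : ℤ) - 1)) *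
          (qfall k N (i + 1) * (qfact k (i + 1))⁻¹) *
          ∏ l ∈ Finset.range (i + 1), (1 - x * v k ^ (-2 * (l : ℤ))) -
        v k ^ (2 * (N : ℤ)) * (1 - x) * ((-1) ^ i * v k ^ ((i : ℤ) * ((N : ℤ) - 1)) *
          (qfall k N i * (qfact k i)⁻¹) *
          ∏ l ∈ Finset.range i, (1 - x * v k ^ (-2 : ℤ) * v k ^ (-2 * (l : ℤ)))) := by
      intro i _
      have hp : ∏ l ∈ Finset.range (i + 1), (1 - x * v k ^ (-2 * (l : ℤ))) =
          (1 - x) * ∏ l ∈ Finset.range i, (1 - x * v k ^ (-2 : ℤ) * v k ^ (-2 * (l : ℤ))) := by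
        rw [Finset.prod_range_succ', mul_comm]
        congr 1
        · simp
        · refine Finset.prod_congr rfl fun l _ => ?_
          rw [mul_assoc, ← zpow_add₀ hv]
          congr 3
          push_cast; ring
      have e1 : v k ^ (((i + 1 : ℕ) : ℤ) * (((N + 1 : ℕ) : ℤ) - 1)) * v k ^ (-((i : ℤ) + 1)) =
          v k ^ (((i + 1 : ℕ) : ℤ) * ((N : ℤ) - 1)) := by
        rw [← zpow_add₀ hv]; congr 1; push_cast; ring
      have e2 : v k ^ (((i + 1 : ℕ) : ℤ) * (((N + 1 : ℕ) : ℤ) - 1)) * v k ^ ((N : ℤ) - i) =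
          v k ^ (2 * (N : ℤ)) * v k ^ ((i : ℤ) * ((N : ℤ) - 1)) := by
        rw [← zpow_add₀ hv, ← zpow_add₀ hv]; congr 1; push_cast; ring
      have hP := qbinom_pascal k N i
      rw [← Nat.cast_succ N] at hP
      rw [hp, hP, pow_succ]
      generalize ∏ l ∈ Finset.range i, (1 - x * v k ^ (-2 : ℤ) * v k ^ (-2 * (l : ℤ))) = y
      linear_combination
        (-(-1) ^ i * (qfall k N (i + 1) * (qfact k (i + 1))⁻¹) * ((1 - x) * y)) * e1 -
          ((-1) ^ i * (qfall k N i * (qfact k i)⁻¹) * ((1 - x) * y)) * e2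
    rw [Finset.sum_congr rfl step, Finset.sum_sub_distrib, ← Finset.mul_sum, key]
    -- The shifted sum lacks the term i = 0, which is 1, and its last term vanishes because
    -- [N]_{(N+1)} = 0.
    have h1 : ∑ i ∈ Finset.range (N + 1),
        (-1) ^ (i + 1) * v k ^ (((i + 1 : ℕ) : ℤ) * ((N : ℤ) - 1)) *
          (qfall k N (i + 1) * (qfact k (i + 1))⁻¹) *
          ∏ l ∈ Finset.range (i + 1), (1 - x * v k ^ (-2 * (l : ℤ))) = x ^ N - 1 := by
      rw [← h0, Finset.sum_range_succ, qfall_eq_zero k (Nat.lt_succ_self N),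
        Finset.sum_range_succ' _ N]
      simp [qfall_zero, qfact_zero]
    rw [h1]
    -- With this the total is (x^N - 1) - (1 - x)x^N + 1 = x^{N+1}.
    have e3 : v k ^ (2 * (N : ℤ)) * (x * v k ^ (-2 : ℤ)) ^ N = x ^ N := by
      rw [mul_pow, mul_left_comm, ← zpow_natCast (v k ^ (-2 : ℤ)), ← zpow_mul, ← zpow_add₀ hv]
      simp
    rw [mul_right_comm, e3]
    simp [qfall_zero, qfact_zero]
    ring

end Calculus

/-! ### The module F_n in its standard basis. -/

section FiniteDimensional

variable (k : Type*) [Field k] (A : Type*) [CommRing A] [Algebra (RatFunc k) A] (n : ℕ)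

theorem finRep_E : finRep k A n (E k A) = finE k A n := lift_E ..

theorem finRep_F : finRep k A n (F k A) = finF k A n := lift_F ..

theorem finRep_K : finRep k A n (K k A) = finK k A n 1 := lift_K ..

theorem finRep_Kinv : finRep k A n (Kinv k A) = finK k A n (-1) := lift_Kinv ..

theorem finF_indicator (j : ℕ) :
    finF k A n (fun i => if (i : ℕ) = j then 1 else 0) =
      algebraMap (RatFunc k) A (qint k ((j : ℤ) + 1)) •
        (fun i : Fin (n + 1) => if (i : ℕ) = j + 1 then (1 : A) else 0) := by
  funext i
  obtain ⟨i, hi⟩ := i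
  simp only [finF, LinearMap.coe_mk, AddHom.coe_mk, Pi.smul_apply, smul_eq_mul]
  rcases i with _ | i
  · simp
  · by_cases h : i = j <;> simp [h]

theorem Fdiv_succ (j : ℕ) : Fdiv k A (j + 1) =
    algebraMap (RatFunc k) A (qint k ((j : ℤ) + 1))⁻¹ • (F k A * Fdiv k A j) := by
  rw [Fdiv, Fdiv, mul_smul_comm, smul_smul, ← map_mul, ← mul_inv, ← qfact_succ, pow_succ']

theorem Ediv_succ (j : ℕ) : Ediv k A (j + 1) =
    algebraMap (RatFunc k) A (qint k ((j : ℤ) + 1))⁻¹ • (E k A * Ediv k A j) := by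
  rw [Ediv, Ediv, mul_smul_comm, smul_smul, ← map_mul, ← mul_inv, ← qfact_succ, pow_succ']

theorem Fdiv_zero : Fdiv k A 0 = 1 := by simp [Fdiv, qfact_zero]

theorem Ediv_zero : Ediv k A 0 = 1 := by simp [Ediv, qfact_zero]

/-- `F F^{(j)} = [j+1] F^{(j+1)}`. -/
theorem F_mul_Fdiv (j : ℕ) : F k A * Fdiv k A j =
    algebraMap (RatFunc k) A (qint k ((j : ℤ) + 1)) • Fdiv k A (j + 1) := by
  rw [Fdiv_succ, smul_smul, ← map_mul, mul_inv_cancel₀ (qint_ne_zero k (by omega)), map_one,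
    one_smul]

/-- Identifies the abstract F^{(j)}u with a coordinate vector. It holds for every j, the indicator
being zero when j > n, so the action formulas below need no bound on j. -/
theorem u_eq_indicator (j : ℕ) : u k A n j = fun i : Fin (n + 1) => if (i : ℕ) = j then (1 : A) else 0 := by
  induction j with
  | zero =>
    funext i
    rw [u, Fdiv_zero, map_one, Module.End.one_apply, Pi.single_apply]
    exact if_congr Fin.ext_iff rfl rfl
  | succ j ih =>
    rw [u, Fdiv_succ, map_smul, map_mul, LinearMap.smul_apply, Module.End.mul_apply]
    rw [u] at ih
    rw [ih, finRep_F, finF_indicator, smul_smul, ← map_mul,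
      inv_mul_cancel₀ (qint_ne_zero k (by omega)), map_one, one_smul]

theorem u_apply (j : ℕ) (i : Fin (n + 1)) : u k A n j i = if (i : ℕ) = j then 1 else 0 :=
  congrFun (u_eq_indicator k A n j) i

theorem finRep_F_u (j : ℕ) : finRep k A n (F k A) (u k A n j) =
    algebraMap (RatFunc k) A (qint k ((j : ℤ) + 1)) • u k A n (j + 1) := by
  rw [finRep_F, u_eq_indicator, finF_indicator, u_eq_indicator]

theorem finRep_E_u_zero : finRep k A n (E k A) (u k A n 0) = 0 := by
  rw [finRep_E, u_eq_indicator]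
  funext i
  simp [finE]

theorem finRep_E_u_succ (j : ℕ) : finRep k A n (E k A) (u k A n (j + 1)) =
    algebraMap (RatFunc k) A (qint k ((n : ℤ) - j)) • u k A n j := by
  rw [finRep_E, u_eq_indicator, u_eq_indicator]
  funext i
  obtain ⟨i, hi⟩ := i
  simp only [finE, LinearMap.coe_mk, AddHom.coe_mk, Pi.smul_apply, smul_eq_mul]
  by_cases h : i < n
  · rw [dif_pos h]
    by_cases h' : i = j
    · subst h'
      simp
    · simp [h']
  · by_cases h' : i = j
    -- Top coordinate i = j = n: the left side is zero by truncation, the right side because [0] =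
    -- 0.
    · have : (n : ℤ) - j = 0 := by omega
      simp [h, this, qint_zero]
    · simp [h, h']

theorem finRep_K_u (j : ℕ) : finRep k A n (K k A) (u k A n j) =
    algebraMap (RatFunc k) A (v k ^ ((n : ℤ) - 2 * j)) • u k A n j := by
  rw [finRep_K, u_eq_indicator]
  funext i
  by_cases h : (i : ℕ) = j <;> simp [finK, h]

theorem finRep_Kinv_u (j : ℕ) : finRep k A n (Kinv k A) (u k A n j) =
    algebraMap (RatFunc k) A (v k ^ (-((n : ℤ) - 2 * j))) • u k A n j := by
  rw [finRep_Kinv, u_eq_indicator]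
  funext i
  by_cases h : (i : ℕ) = j <;> simp [finK, h]

theorem u_eq_zero {j : ℕ} (h : n < j) : u k A n j = 0 := by
  rw [u_eq_indicator]
  funext i
  have : (i : ℕ) ≠ j := by omega
  simp [this]

theorem finE_pow_apply (j : ℕ) (f : Fin (n + 1) → A) (i : Fin (n + 1)) (h : n < i + j) :
    (finE k A n ^ j) f i = 0 := by
  induction j generalizing i with
  | zero => omega
  | succ j ih =>
    rw [pow_succ', Module.End.mul_apply]
    simp only [finE, LinearMap.coe_mk, AddHom.coe_mk]
    split_ifs with hi
    · have := ih ⟨i + 1, by omega⟩ (by simp; omega)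
      simp only [finE] at this
      rw [this, mul_zero]
    · rfl

theorem finRep_E_pow : finRep k A n (E k A) ^ (n + 1) = 0 := by
  rw [finRep_E]
  apply LinearMap.ext
  intro f
  funext i
  exact finE_pow_apply k A n _ f i (by omega)

/-- `E^{(i)} u_{q+i} = [n-q]_{(i)} / [i]! u_q`. -/
theorem finRep_Ediv_u (q i : ℕ) : finRep k A n (Ediv k A i) (u k A n (q + i)) =
    algebraMap (RatFunc k) A (qfall k ((n : ℤ) - q) i * (qfact k i)⁻¹) • u k A n q := by
  induction i generalizing q with
  | zero => simp [Ediv_zero, qfall_zero, qfact_zero]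
  | succ i ih =>
    have := ih (q + 1)
    rw [Ediv_succ, map_smul, map_mul, LinearMap.smul_apply, Module.End.mul_apply,
      ← add_assoc, add_right_comm, this, map_smul, finRep_E_u_succ, smul_smul, smul_smul,
      ← map_mul, ← map_mul]
    congr 2
    rw [show (n : ℤ) - q = (n : ℤ) - (q + 1 : ℕ) + 1 by push_cast; ring, qfall_succ_left,
      qfact_succ, mul_inv]
    ring

end FiniteDimensional

/-! ### Invertibility of L. -/

section QuasiR

variable {k : Type*} [Field k] {A : Type*} [CommRing A] [Algebra (RatFunc k) A]

/-- Truncations of mutually inverse power series at a nilpotent element are mutually inverse. -/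
theorem sum_smul_pow_mul_eq_one {B : Type*} [Ring B] [Algebra A B] {X : B} {N : ℕ}
    (hX : X ^ (N + 1) = 0) (a b : ℕ → A) (h0 : a 0 * b 0 = 1)
    (hab : ∀ m, ∑ x ∈ Finset.HasAntidiagonal.antidiagonal (m + 1), a x.1 * b x.2 = 0) :
    (∑ i ∈ Finset.range (N + 1), a i • X ^ i) * (∑ j ∈ Finset.range (N + 1), b j • X ^ j) =
      1 := by
  have hpow : ∀ m, N + 1 ≤ m → X ^ m = 0 := fun m hm => pow_eq_zero_of_le hm hX
  -- Products with i + j > N vanish, so the square of indices shrinks to a triangle, which is then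
  -- summed along antidiagonals.
  have h1 : (∑ i ∈ Finset.range (N + 1), a i • X ^ i) *
      (∑ j ∈ Finset.range (N + 1), b j • X ^ j) =
      ∑ i ∈ Finset.range (N + 1), ∑ j ∈ Finset.range (N + 1 - i), (a i * b j) • X ^ (i + j) := by
    rw [Finset.sum_mul]
    refine Finset.sum_congr rfl fun i hi => ?_
    rw [Finset.mul_sum]
    symm
    refine Finset.sum_subset_zero_on_sdiff ?_ ?_ ?_
    · exact Finset.range_subset_range.2 (Nat.sub_le _ _)
    · intro j hj
      have := (Finset.mem_sdiff.1 hj).2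
      rw [Finset.mem_range, not_lt] at this
      rw [smul_mul_smul_comm, ← pow_add, hpow _ (by omega), smul_zero]
    · intro j _
      rw [smul_mul_smul_comm, pow_add]
  rw [h1, ← Finset.sum_range_diag_flip (N + 1) (fun i j => (a i * b j) • X ^ (i + j)),
    Finset.sum_range_succ', Finset.sum_eq_zero, zero_add]
  · simp [h0]
  · intro m _
    have := hab m
    rw [Finset.Nat.sum_antidiagonal_eq_sum_range_succ (fun i j => a i * b j)] at this
    have h2 : ∀ i ∈ Finset.range (m + 1 + 1), (a i * b (m + 1 - i)) • X ^ (i + (m + 1 - i)) =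
        (a i * b (m + 1 - i)) • X ^ (m + 1) := by
      intro i hi
      rw [Nat.add_sub_cancel' (by rw [Finset.mem_range] at hi; omega)]
    rw [Finset.sum_congr rfl h2, ← Finset.sum_smul, this, zero_smul]

variable {V W : Type*} [AddCommGroup V] [Module A V] [AddCommGroup W] [Module A W]
  (ρ : QU k A →ₐ[A] Module.End A V) (σ : QU k A →ₐ[A] Module.End A W)

theorem map_Fdiv_Ediv (j : ℕ) :
    TensorProduct.map (ρ (Fdiv k A j)) (σ (Ediv k A j)) =
      algebraMap (RatFunc k) A ((qfact k j)⁻¹ * (qfact k j)⁻¹) •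
        TensorProduct.map (ρ (F k A)) (σ (E k A)) ^ j := by
  rw [Fdiv, Ediv, map_smul, map_smul, map_pow, map_pow, TensorProduct.map_smul_left,
    TensorProduct.map_smul_right, smul_smul, ← map_mul, TensorProduct.map_pow]

theorem map_Fdiv_Ediv_eq_zero {N : ℕ} (h : σ (E k A) ^ (N + 1) = 0) {j : ℕ} (hj : N + 1 ≤ j) :
    TensorProduct.map (ρ (Fdiv k A j)) (σ (Ediv k A j)) = 0 := by
  rw [Ediv, map_smul, map_pow, pow_eq_zero_of_le hj h, smul_zero, TensorProduct.map_zero_right]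

/-- A `finsum` with infinite support is zero by convention; nilpotency of E on the second factor
excludes that case. -/
theorem finsum_map_Fdiv_Ediv {N : ℕ} (h : σ (E k A) ^ (N + 1) = 0) (c : ℕ → RatFunc k)
    (z : V ⊗[A] W) :
    ∑ᶠ j : ℕ, algebraMap (RatFunc k) A (c j) •
        TensorProduct.map (ρ (Fdiv k A j)) (σ (Ediv k A j)) z =
      ∑ j ∈ Finset.range (N + 1), algebraMap (RatFunc k) A (c j) •
        TensorProduct.map (ρ (Fdiv k A j)) (σ (Ediv k A j)) z := by
  refine finsum_eq_sum_of_support_subset _ fun j hj => ?_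
  rw [Finset.coe_range, Set.mem_Iio]
  by_contra hj'
  refine hj (?_ : _ • TensorProduct.map _ _ z = 0)
  rw [map_Fdiv_Ediv_eq_zero ρ σ h (not_lt.1 hj'), LinearMap.zero_apply, smul_zero]

/-- Since {j} = (v - v⁻¹)^j [j]!, one of the two q-factorials cancels and a v-exponential in the
single operator F ⊗ E remains. -/
theorem sum_map_Fdiv_Ediv (N : ℕ) (c : ℕ → RatFunc k) (z : V ⊗[A] W) :
    ∑ j ∈ Finset.range (N + 1), algebraMap (RatFunc k) A (c j * qbrace k j) •
        TensorProduct.map (ρ (Fdiv k A j)) (σ (Ediv k A j)) z =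
      (∑ j ∈ Finset.range (N + 1),
        algebraMap (RatFunc k) A ((v k - (v k)⁻¹) ^ j * (c j * (qfact k j)⁻¹)) •
        TensorProduct.map (ρ (F k A)) (σ (E k A)) ^ j : Module.End A (V ⊗[A] W)) z := by
  rw [LinearMap.sum_apply]
  refine Finset.sum_congr rfl fun j _ => ?_
  have := qfact_ne_zero k j
  rw [map_Fdiv_Ediv, LinearMap.smul_apply, LinearMap.smul_apply, smul_smul, ← map_mul, qbrace_eq]
  congr 2
  field_simp

/-- Rescaling the variable by v - v⁻¹ multiplies the degree m+1 identity by a common factor. -/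
theorem sum_antidiagonal_qexp_algebraMap (m : ℕ) :
    ∑ x ∈ Finset.HasAntidiagonal.antidiagonal (m + 1),
      algebraMap (RatFunc k) A ((v k - (v k)⁻¹) ^ x.1 *
        (((-1) ^ x.1 * v k ^ (-((x.1 * (x.1 - 1) / 2 : ℕ) : ℤ))) * (qfact k x.1)⁻¹)) *
      algebraMap (RatFunc k) A ((v k - (v k)⁻¹) ^ x.2 *
        (v k ^ ((x.2 * (x.2 - 1) / 2 : ℕ) : ℤ) * (qfact k x.2)⁻¹)) = 0 := by
  have h : ∀ x ∈ Finset.HasAntidiagonal.antidiagonal (m + 1),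
      algebraMap (RatFunc k) A ((v k - (v k)⁻¹) ^ x.1 *
        (((-1) ^ x.1 * v k ^ (-((x.1 * (x.1 - 1) / 2 : ℕ) : ℤ))) * (qfact k x.1)⁻¹)) *
      algebraMap (RatFunc k) A ((v k - (v k)⁻¹) ^ x.2 *
        (v k ^ ((x.2 * (x.2 - 1) / 2 : ℕ) : ℤ) * (qfact k x.2)⁻¹)) =
      algebraMap (RatFunc k) A ((v k - (v k)⁻¹) ^ (m + 1) *
        (((-1) ^ x.1 * v k ^ (-((x.1 * (x.1 - 1) / 2 : ℕ) : ℤ)) * (qfact k x.1)⁻¹) *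
        (v k ^ ((x.2 * (x.2 - 1) / 2 : ℕ) : ℤ) * (qfact k x.2)⁻¹))) := by
    intro x hx
    rw [← map_mul, ← Finset.HasAntidiagonal.mem_antidiagonal.1 hx, pow_add]
    congr 1
    ring
  rw [Finset.sum_congr rfl h, ← map_sum, ← Finset.mul_sum, sum_antidiagonal_qexp, mul_zero,
    map_zero]

/-- The quasi-`R`-matrix is invertible when `E` is nilpotent on the second factor. -/
theorem leftInverse_Linv_L {N : ℕ} (h : σ (E k A) ^ (N + 1) = 0) :
    Function.LeftInverse (Linv ρ σ) (L ρ σ) := by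
  intro z
  have hX : TensorProduct.map (ρ (F k A)) (σ (E k A)) ^ (N + 1) = 0 := by
    rw [TensorProduct.map_pow, h, TensorProduct.map_zero_right]
  rw [Linv, finsum_map_Fdiv_Ediv ρ σ h, L, finsum_map_Fdiv_Ediv ρ σ h, sum_map_Fdiv_Ediv,
    sum_map_Fdiv_Ediv, ← Module.End.mul_apply, sum_smul_pow_mul_eq_one hX, Module.End.one_apply]
  · simp [qfact_zero]
  · intro m
    have := sum_antidiagonal_qexp_algebraMap (k := k) (A := A) m
    rw [← Finset.Nat.sum_antidiagonal_swap] at this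
    rw [← this]
    exact Finset.sum_congr rfl fun x _ => mul_comm _ _

theorem rightInverse_Linv_L {N : ℕ} (h : σ (E k A) ^ (N + 1) = 0) :
    Function.RightInverse (Linv ρ σ) (L ρ σ) := by
  intro z
  have hX : TensorProduct.map (ρ (F k A)) (σ (E k A)) ^ (N + 1) = 0 := by
    rw [TensorProduct.map_pow, h, TensorProduct.map_zero_right]
  rw [Linv, finsum_map_Fdiv_Ediv ρ σ h, L, finsum_map_Fdiv_Ediv ρ σ h, sum_map_Fdiv_Ediv,
    sum_map_Fdiv_Ediv, ← Module.End.mul_apply, sum_smul_pow_mul_eq_one hX, Module.End.one_apply]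
  · simp [qfact_zero]
  · exact sum_antidiagonal_qexp_algebraMap

end QuasiR

/-! ### The elements [t;m] of R and their inverses. -/

section TCalculus

variable {k : Type*} [Field k]

theorem Tint_eq (t : (R k)ˣ) (m : ℤ) : Tint t m =
    toR (v k - (v k)⁻¹)⁻¹ * (toR (v k ^ m) * (t : R k)) -
      toR (v k - (v k)⁻¹)⁻¹ * (toR (v k ^ (-m)) * ((t⁻¹ : (R k)ˣ) : R k)) :=
  mul_sub _ _ _

theorem Tint_neg (t : (R k)ˣ) (m : ℤ) : Tint t (-m) = -Tint t⁻¹ m := by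
  rw [Tint, Tint, neg_neg, inv_inv]
  ring

/-- Compare the coefficients of t and of t⁻¹. This is the induction step for the action of E on
F^{(j)}x. -/
theorem qint_mul_Tint_succ (t : (R k)ˣ) (j b : ℤ) :
    toR (qint k j) * Tint t (b + 1) + Tint t (b - j) = toR (qint k (j + 1)) * Tint t b := by
  have hv := v_ne_zero k
  have h1 : qint k j * v k ^ (b + 1) + v k ^ (b - j) = qint k (j + 1) * v k ^ b := by
    rw [qint_add, qint_one, zpow_one, zpow_add_one₀ hv, sub_eq_add_neg, zpow_add₀ hv]
    ring
  have h2 : qint k j * v k ^ (-(b + 1)) + v k ^ (-(b - j)) = qint k (j + 1) * v k ^ (-b) := by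
    rw [add_comm j 1, qint_add, qint_one, neg_add, zpow_add₀ hv, neg_sub, sub_eq_add_neg,
      zpow_add₀ hv]
    ring
  have h1' := congrArg (algebraMap (RatFunc k) (R k)) h1
  have h2' := congrArg (algebraMap (RatFunc k) (R k)) h2
  rw [map_add, map_mul, map_mul] at h1' h2'
  rw [Tint_eq, Tint_eq, Tint_eq]
  linear_combination toR (v k - (v k)⁻¹)⁻¹ * (t : R k) * h1' -
    toR (v k - (v k)⁻¹)⁻¹ * ((t⁻¹ : (R k)ˣ) : R k) * h2'

/-- The analogous induction step for the action of F on F^{(-j)}x. -/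
theorem qint_mul_Tint_self (t : (R k)ˣ) (j : ℤ) :
    toR (qint k j) * Tint t j + Tint t (2 * j + 1) = toR (qint k (j + 1)) * Tint t (j + 1) := by
  have hv := v_ne_zero k
  have h1 : qint k j * v k ^ j + v k ^ (2 * j + 1) = qint k (j + 1) * v k ^ (j + 1) := by
    rw [add_comm j 1, qint_add, qint_one, show 2 * j + 1 = j + (1 + j) by ring, zpow_add₀ hv,
      zpow_add₀ hv, zpow_neg, zpow_one]
    field_simp
    ring
  have h2 : qint k j * v k ^ (-j) + v k ^ (-(2 * j + 1)) =
      qint k (j + 1) * v k ^ (-(j + 1)) := by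
    rw [qint_add, qint_one, show -(2 * j + 1) = -j + -(j + 1) by ring, zpow_add₀ hv,
      neg_add, zpow_add₀ hv, zpow_neg _ 1, zpow_one]
    field_simp
  have h1' := congrArg (algebraMap (RatFunc k) (R k)) h1
  have h2' := congrArg (algebraMap (RatFunc k) (R k)) h2
  rw [map_add, map_mul, map_mul] at h1' h2'
  rw [Tint_eq, Tint_eq, Tint_eq]
  linear_combination toR (v k - (v k)⁻¹)⁻¹ * (t : R k) * h1' -
    toR (v k - (v k)⁻¹)⁻¹ * ((t⁻¹ : (R k)ˣ) : R k) * h2'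

theorem Tfall_zero (t : (R k)ˣ) (m : ℤ) : Tfall t m 0 = 1 := rfl

theorem Tfall_succ (t : (R k)ˣ) (m : ℤ) (j : ℕ) :
    Tfall t m (j + 1) = Tfall t m j * Tint t (m - j) :=
  Finset.prod_range_succ _ _

theorem Tfall_succ_left (t : (R k)ˣ) (m : ℤ) (j : ℕ) :
    Tfall t (m + 1) (j + 1) = Tint t (m + 1) * Tfall t m j := by
  rw [Tfall, Finset.prod_range_succ', mul_comm]
  congr 1
  · simp
  · exact Finset.prod_congr rfl fun i _ => by congr 1; push_cast; ring

theorem constantCoeff_T : PowerSeries.constantCoeff (T k : R k) = 1 := by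
  simp [T]

theorem constantCoeff_T_inv : PowerSeries.constantCoeff ((T k)⁻¹ : (R k)ˣ).val = 1 := by
  have h := congrArg PowerSeries.constantCoeff (T k).mul_inv
  rwa [map_mul, constantCoeff_T, one_mul, map_one] at h

theorem constantCoeff_toR (a : RatFunc k) : PowerSeries.constantCoeff (toR a) = a := by
  simp [toR]

/-- Setting T = 1 turns [t;m] into [m]. Hence [t;m] is invertible for m ≠ 0, and the power series
inverse, which is zero on non-units, is a genuine one in the coefficients. -/
theorem constantCoeff_Tint {t : (R k)ˣ} (ht : PowerSeries.constantCoeff (t : R k) = 1) (m : ℤ) :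
    PowerSeries.constantCoeff (Tint t m) = qint k m := by
  have h := congrArg PowerSeries.constantCoeff t.mul_inv
  rw [map_mul, ht, one_mul, map_one] at h
  rw [Tint, map_mul, map_sub, map_mul, map_mul, ht, h, constantCoeff_toR, constantCoeff_toR,
    constantCoeff_toR, mul_one, mul_one, qint, inv_mul_eq_div]

theorem Tint_mul_inv_Tfall {t : (R k)ˣ} (ht : PowerSeries.constantCoeff (t : R k) = 1) (j : ℕ) :
    Tint t ((j : ℤ) + 1) * (Tfall t ((j + 1 : ℕ) : ℤ) (j + 1))⁻¹ = (Tfall t j j)⁻¹ := by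
  rw [Nat.cast_succ, Tfall_succ_left, PowerSeries.mul_inv_rev, mul_left_comm,
    PowerSeries.mul_inv_cancel, mul_one]
  rw [constantCoeff_Tint ht]
  exact qint_ne_zero k (by omega)

theorem Tfall_mul_inv_Tfall {t : (R k)ˣ} (ht : PowerSeries.constantCoeff (t : R k) = 1)
    (s i : ℕ) :
    Tfall t ((s : ℤ) + i) i * (Tfall t ((s + i : ℕ) : ℤ) (s + i))⁻¹ = (Tfall t s s)⁻¹ := by
  induction i with
  | zero => simp [Tfall_zero]
  | succ i ih =>
    have h := Tint_mul_inv_Tfall ht (s + i)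
    rw [← ih, ← add_assoc, ← h, Nat.cast_succ, ← add_assoc, Tfall_succ_left]
    push_cast
    ring

theorem units_inv_eq (g : (R k)ˣ) : (g : R k)⁻¹ = ((g⁻¹ : (R k)ˣ) : R k) := by
  have h : PowerSeries.constantCoeff (g : R k) ≠ 0 :=
    (g.isUnit.map (PowerSeries.constantCoeff (R := RatFunc k))).ne_zero
  rw [PowerSeries.inv_eq_iff_mul_eq_one h, Units.inv_mul]

theorem inv_units_mul (g : (R k)ˣ) (x : R k) :
    ((g : R k) * x)⁻¹ = ((g⁻¹ : (R k)ˣ) : R k) * x⁻¹ := by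
  rw [PowerSeries.mul_inv_rev, units_inv_eq, mul_comm]

theorem wt_mul (a b : ℤ) : wt k a * toR (v k ^ b) = wt k (a + b) := by
  rw [wt, wt, mul_assoc, ← map_mul, ← zpow_add₀ (v_ne_zero k)]

theorem T_inv_mul_wt (a : ℤ) :
    (((T k)⁻¹ : (R k)ˣ) : R k) * toR (v k ^ (-a)) * wt k a = 1 := by
  rw [wt, mul_mul_mul_comm, Units.inv_mul, ← map_mul, ← zpow_add₀ (v_ne_zero k)]
  simp

end TCalculus

/-! ### Action of E, F, K on F^{(j)}x and F^{(-j)}x for a weight vector x. -/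

section Weights

variable {k : Type*} [Field k] {V : Type*} [AddCommGroup V] [Module (R k) V]
  (ρ : QU k (R k) →ₐ[R k] Module.End (R k) V) {x : V} {a : ℤ}

theorem rep_Kinv_of_weight (h : ρ (K k (R k)) x = wt k a • x) :
    ρ (Kinv k (R k)) x = ((((T k)⁻¹ : (R k)ˣ) : R k) * toR (v k ^ (-a))) • x := by
  have h1 := LinearMap.congr_fun (congrArg ρ (rel_KinvK k (R k))) x
  rw [map_mul, Module.End.mul_apply, h, map_smul, map_one, Module.End.one_apply] at h1
  nth_rewrite 2 [← h1]
  rw [smul_smul, T_inv_mul_wt, one_smul]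

theorem rep_E_F_of_weight (h : ρ (K k (R k)) x = wt k a • x) :
    ρ (E k (R k)) (ρ (F k (R k)) x) = ρ (F k (R k)) (ρ (E k (R k)) x) + Tint (T k) a • x := by
  have h1 := LinearMap.congr_fun (congrArg ρ (rel_EF k (R k))) x
  rw [map_sub, map_mul, map_mul, map_smul, map_sub, LinearMap.sub_apply, Module.End.mul_apply,
    Module.End.mul_apply, LinearMap.smul_apply, LinearMap.sub_apply, h, rep_Kinv_of_weight ρ h,
    sub_eq_iff_eq_add'] at h1
  rw [h1, ← sub_smul, smul_smul, Tint, wt, mul_comm (T k : R k), mul_comm (((T k)⁻¹ : (R k)ˣ) : R k)]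

theorem rep_K_F_of_weight (h : ρ (K k (R k)) x = wt k a • x) :
    ρ (K k (R k)) (ρ (F k (R k)) x) = wt k (a - 2) • ρ (F k (R k)) x := by
  have h1 := LinearMap.congr_fun (congrArg ρ (K_mul_F k (R k))) x
  rw [map_mul, map_smul, map_mul, LinearMap.smul_apply, Module.End.mul_apply,
    Module.End.mul_apply, h, map_smul, smul_smul, mul_comm, wt_mul] at h1
  exact h1

theorem rep_K_E_of_weight (h : ρ (K k (R k)) x = wt k a • x) :
    ρ (K k (R k)) (ρ (E k (R k)) x) = wt k (a + 2) • ρ (E k (R k)) x := by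
  have h1 := LinearMap.congr_fun (congrArg ρ (K_mul_E k (R k))) x
  rw [map_mul, map_smul, map_mul, LinearMap.smul_apply, Module.End.mul_apply,
    Module.End.mul_apply, h, map_smul, smul_smul, mul_comm, wt_mul] at h1
  exact h1

theorem rep_Fdiv_zero (x : V) : ρ (Fdiv k (R k) 0) x = x := by
  rw [Fdiv_zero, map_one, Module.End.one_apply]

theorem rep_Fdiv_succ (j : ℕ) (x : V) : ρ (Fdiv k (R k) (j + 1)) x =
    toR (qint k ((j : ℤ) + 1))⁻¹ • ρ (F k (R k)) (ρ (Fdiv k (R k) j) x) := by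
  rw [Fdiv_succ, map_smul, map_mul, LinearMap.smul_apply, Module.End.mul_apply]

theorem rep_F_Fdiv (j : ℕ) (x : V) : ρ (F k (R k)) (ρ (Fdiv k (R k) j) x) =
    toR (qint k ((j : ℤ) + 1)) • ρ (Fdiv k (R k) (j + 1)) x := by
  rw [← Module.End.mul_apply, ← map_mul, F_mul_Fdiv, map_smul, LinearMap.smul_apply]

theorem rep_K_Fdiv (h : ρ (K k (R k)) x = wt k a • x) (j : ℕ) :
    ρ (K k (R k)) (ρ (Fdiv k (R k) j) x) = wt k (a - 2 * j) • ρ (Fdiv k (R k) j) x := by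
  induction j with
  | zero => simpa [rep_Fdiv_zero] using h
  | succ j ih =>
    rw [rep_Fdiv_succ, map_smul, rep_K_F_of_weight ρ ih, smul_comm]
    congr 2
    push_cast; ring

theorem toR_inv_mul {b : RatFunc k} (hb : b ≠ 0) : toR b⁻¹ * toR b = 1 := by
  rw [← map_mul, inv_mul_cancel₀ hb, map_one]

theorem rep_E_Fdiv_succ (hE : ρ (E k (R k)) x = 0) (h : ρ (K k (R k)) x = wt k a • x) (j : ℕ) :
    ρ (E k (R k)) (ρ (Fdiv k (R k) (j + 1)) x) =
      Tint (T k) (a - j) • ρ (Fdiv k (R k) j) x := by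
  induction j with
  | zero =>
    rw [rep_Fdiv_succ, rep_Fdiv_zero, map_smul, rep_E_F_of_weight ρ h, hE, map_zero, zero_add]
    simp [qint_one]
  | succ j ih =>
    have hne := qint_ne_zero k (m := ((j + 1 : ℕ) : ℤ) + 1) (by omega)
    have hT := qint_mul_Tint_succ (T k) ((j : ℤ) + 1) (a - (j + 1))
    rw [rep_Fdiv_succ ρ (j + 1), map_smul, rep_E_F_of_weight ρ (rep_K_Fdiv ρ h (j + 1)), ih,
      map_smul, rep_F_Fdiv, smul_smul, ← add_smul, smul_smul]
    congr 1
    rw [show a - ((j : ℤ) + 1) + 1 = a - j by ring,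
      show a - ((j : ℤ) + 1) - (j + 1) = a - 2 * (j + 1 : ℕ) by push_cast; ring] at hT
    rw [mul_comm (Tint _ _), hT, ← mul_assoc, Nat.cast_succ, ← Nat.cast_succ, Nat.cast_succ,
      toR_inv_mul (by exact_mod_cast hne), one_mul]

theorem Fneg_zero (x : V) : Fneg ρ 0 x = x := by
  rw [Fneg, Fdiv_zero, map_one, map_one, Module.End.one_apply]

/-- Lusztig's automorphism sends F to -EK, so F^{(-j)} is, up to scalars, an iterated raising
operator. -/
theorem Fneg_succ (j : ℕ) (x : V) : Fneg ρ (j + 1) x =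
    -(toR (qint k ((j : ℤ) + 1))⁻¹ • ρ (E k (R k)) (ρ (K k (R k)) (Fneg ρ j x))) := by
  have h : Tprime k (R k) (F k (R k)) = -(E k (R k) * K k (R k)) := lift_F ..
  rw [Fneg, Fdiv_succ, map_smul, map_mul, h, map_smul, map_mul, map_neg, map_mul,
    LinearMap.smul_apply, neg_mul, LinearMap.neg_apply, smul_neg]
  rfl

theorem rep_K_Fneg (h : ρ (K k (R k)) x = wt k a • x) (j : ℕ) :
    ρ (K k (R k)) (Fneg ρ j x) = wt k (a + 2 * j) • Fneg ρ j x := by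
  induction j with
  | zero => simpa [Fneg_zero] using h
  | succ j ih =>
    rw [Fneg_succ, ih, map_smul, map_neg, map_smul, map_smul, rep_K_E_of_weight ρ ih, smul_neg]
    congr 1
    rw [smul_smul, smul_smul, smul_smul, smul_smul]
    congr 1
    rw [show a + 2 * ((j + 1 : ℕ) : ℤ) = a + 2 * j + 2 by push_cast; ring]
    ring

theorem rep_E_Fneg (h : ρ (K k (R k)) x = wt k a • x) (j : ℕ) :
    wt k (a + 2 * j) • ρ (E k (R k)) (Fneg ρ j x) =
      -(toR (qint k ((j : ℤ) + 1)) • Fneg ρ (j + 1) x) := by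
  rw [Fneg_succ, smul_neg, neg_neg, smul_smul, mul_comm (toR _),
    toR_inv_mul (qint_ne_zero k (m := (j : ℤ) + 1) (by omega)), one_smul, rep_K_Fneg ρ h,
    map_smul]

theorem rep_F_Fneg_succ (hF : ρ (F k (R k)) x = 0) (h : ρ (K k (R k)) x = wt k 1 • x) (j : ℕ) :
    ρ (F k (R k)) (Fneg ρ (j + 1) x) =
      (wt k (1 + 2 * j) * Tint (T k) ((j : ℤ) + 1)) • Fneg ρ j x := by
  -- The claim at j only needs EF on F^{(-j)}x, since FE = EF - [T;1+2j] there. For j = 0 this is Fx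
  -- = 0; for j+1 it follows from the claim at j.
  have step : ∀ j : ℕ, ρ (E k (R k)) (ρ (F k (R k)) (Fneg ρ j x)) =
      -(toR (qint k j) * Tint (T k) j) • Fneg ρ j x → ρ (F k (R k)) (Fneg ρ (j + 1) x) =
      (wt k (1 + 2 * j) * Tint (T k) ((j : ℤ) + 1)) • Fneg ρ j x := by
    intro j hj
    have h1 := rep_E_F_of_weight ρ (rep_K_Fneg ρ h j)
    rw [hj, ← sub_eq_iff_eq_add, ← sub_smul] at h1
    have hT := qint_mul_Tint_self (T k) j
    rw [Fneg_succ, rep_K_Fneg ρ h, map_smul, map_neg, map_smul, map_smul, ← h1, smul_smul,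
      smul_smul, ← neg_smul]
    congr 1
    have hi := toR_inv_mul (qint_ne_zero k (m := (j : ℤ) + 1) (by omega))
    rw [add_comm (2 * (j : ℤ))] at hT
    linear_combination toR (qint k ((j : ℤ) + 1))⁻¹ * wt k (1 + 2 * j) * hT +
      wt k (1 + 2 * j) * Tint (T k) ((j : ℤ) + 1) * hi
  refine step j ?_
  induction j with
  | zero => simp [Fneg_zero, hF, qint_zero]
  | succ j ih =>
    rw [step j ih, map_smul, mul_comm, mul_smul, rep_E_Fneg ρ h, smul_neg, smul_smul, ← neg_smul,
      mul_comm]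
    push_cast
    rfl

end Weights

/-! ### The comultiplication on pure tensors. -/

section Tensor

variable {k : Type*} [Field k] {A : Type*} [CommRing A] [Algebra (RatFunc k) A]
  {V W : Type*} [AddCommGroup V] [Module A V] [AddCommGroup W] [Module A W]
  (ρ : QU k A →ₐ[A] Module.End A V) (σ : QU k A →ₐ[A] Module.End A W)

theorem tensorRep_apply (a : QU k A) {b : QU k A ⊗[A] QU k A} (h : comul k A a = b) :
    tensorRep ρ σ a = (Module.endTensorEndAlgHom (R := A) (S := A) (A := A) (M := V) (N := W))
      (Algebra.TensorProduct.map ρ σ b) := by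
  rw [← h]
  rfl

theorem tensorRep_E (x : V) (y : W) : tensorRep ρ σ (E k A) (x ⊗ₜ y) =
    ρ (E k A) x ⊗ₜ y + ρ (K k A) x ⊗ₜ σ (E k A) y := by
  rw [tensorRep_apply ρ σ _ (lift_E ..), map_add, map_add, LinearMap.add_apply,
    Algebra.TensorProduct.map_tmul, Algebra.TensorProduct.map_tmul,
    Module.endTensorEndAlgHom_apply, Module.endTensorEndAlgHom_apply, map_one]
  rfl

theorem tensorRep_F (x : V) (y : W) : tensorRep ρ σ (F k A) (x ⊗ₜ y) =
    x ⊗ₜ σ (F k A) y + ρ (F k A) x ⊗ₜ σ (Kinv k A) y := by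
  rw [tensorRep_apply ρ σ _ (lift_F ..), map_add, map_add, LinearMap.add_apply,
    Algebra.TensorProduct.map_tmul, Algebra.TensorProduct.map_tmul,
    Module.endTensorEndAlgHom_apply, Module.endTensorEndAlgHom_apply, map_one]
  rfl

theorem tensorRep_K (x : V) (y : W) : tensorRep ρ σ (K k A) (x ⊗ₜ y) =
    ρ (K k A) x ⊗ₜ σ (K k A) y := by
  rw [tensorRep_apply ρ σ _ (lift_K ..), Algebra.TensorProduct.map_tmul,
    Module.endTensorEndAlgHom_apply]
  rfl

end Tensor

theorem toR_mul {k : Type*} [Field k] (a b : RatFunc k) : toR (a * b) = toR a * toR b :=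
  map_mul _ _ _

/-! ### Extremal vectors in tensor products with F_n. -/

section Vectors

variable {k : Type*} [Field k] {V : Type*} [AddCommGroup V] [Module (R k) V]
  (ρ : QU k (R k) →ₐ[R k] Module.End (R k) V)

/-- The coefficient of `F^{(j)} w ⊗ u_{p-j}` in the highest weight vectors. -/
noncomputable def highCoeff (k : Type*) [Field k] (q : ℤ) (j : ℕ) : R k :=
  toR (qfall k (q + j) j * v k ^ (-(j : ℤ) ^ 2)) *
    (((T k ^ (-(j : ℤ)) : (R k)ˣ) : R k) * Tfall (T k)⁻¹ j j)⁻¹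

/-- The coefficient of `F^{(-j)} m ⊗ u_{p+j}` in the lowest weight vectors. -/
noncomputable def lowCoeff (k : Type*) [Field k] (q r : ℤ) (j : ℕ) : R k :=
  (-1) ^ j * toR (qfall k (q + j) j * v k ^ (-(j : ℤ) * (-r + 2 * j + 1))) *
    (((T k ^ j : (R k)ˣ) : R k) * Tfall (T k) j j)⁻¹

theorem highCoeff_zero (q : ℤ) : highCoeff k q 0 = 1 := by
  simp [highCoeff, qfall_zero, Tfall_zero]

theorem lowCoeff_zero (q r : ℤ) : lowCoeff k q r 0 = 1 := by
  simp [lowCoeff, qfall_zero, Tfall_zero]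

/-- With q = n - p, this is the condition that the E ⊗ 1 part of term j+1 cancels the K ⊗ E part of
term j. -/
theorem highCoeff_succ (q : ℤ) (j : ℕ) :
    highCoeff k q (j + 1) * Tint (T k)⁻¹ ((j : ℤ) + 1) =
      highCoeff k q j * (wt k (-1 - 2 * j) * toR (qint k (q + j + 1))) := by
  have hv := v_ne_zero k
  have h1 := Tint_mul_inv_Tfall constantCoeff_T_inv (k := k) j
  have h2 : (((T k ^ (-((j + 1 : ℕ) : ℤ)))⁻¹ : (R k)ˣ) : R k) =
      (((T k ^ (-(j : ℤ)))⁻¹ : (R k)ˣ) : R k) * T k := by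
    rw [← Units.val_mul, ← zpow_neg, ← zpow_neg, neg_neg, neg_neg, Nat.cast_succ, zpow_add_one]
  have h3 : qfall k (q + (j + 1 : ℕ)) (j + 1) * v k ^ (-((j + 1 : ℕ) : ℤ) ^ 2) =
      qfall k (q + j) j * v k ^ (-(j : ℤ) ^ 2) *
        (v k ^ (-1 - 2 * (j : ℤ)) * qint k (q + j + 1)) := by
    have h4 : v k ^ (-((j + 1 : ℕ) : ℤ) ^ 2) =
        v k ^ (-(j : ℤ) ^ 2) * v k ^ (-1 - 2 * (j : ℤ)) := by
      rw [← zpow_add₀ hv]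
      congr 1
      push_cast; ring
    rw [h4, Nat.cast_succ, ← add_assoc, qfall_succ_left]
    ring
  rw [highCoeff, highCoeff, inv_units_mul, inv_units_mul, h2, h3, toR_mul (_ * _), toR_mul (v k ^ _), wt, ← h1]
  ring

/-- For n = 2q + r the last power of v is the eigenvalue of K⁻¹ on u_{q+j+1}; the relation then
makes the F ⊗ K⁻¹ part of term j+1 cancel the 1 ⊗ F part of term j. -/
theorem lowCoeff_succ (q r : ℤ) (j : ℕ) :
    lowCoeff k q r (j + 1) * (wt k (1 + 2 * j) * Tint (T k) ((j : ℤ) + 1)) *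
        toR (v k ^ (2 * (q + j + 1) - (2 * q + r))) =
      -(lowCoeff k q r j * toR (qint k (q + j + 1))) := by
  have hv := v_ne_zero k
  have h1 := Tint_mul_inv_Tfall constantCoeff_T (k := k) j
  have h2 : (((T k ^ (j + 1))⁻¹ : (R k)ˣ) : R k) * T k =
      (((T k ^ j)⁻¹ : (R k)ˣ) : R k) := by
    rw [← Units.val_mul, pow_succ, mul_inv_rev, mul_comm, mul_inv_cancel_left]
  have h3 : qfall k (q + (j + 1 : ℕ)) (j + 1) *
        v k ^ (-((j + 1 : ℕ) : ℤ) * (-r + 2 * (j + 1 : ℕ) + 1)) *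
        (v k ^ (1 + 2 * (j : ℤ)) * v k ^ (2 * (q + j + 1) - (2 * q + r))) =
      qfall k (q + j) j * v k ^ (-(j : ℤ) * (-r + 2 * j + 1)) * qint k (q + j + 1) := by
    have h4 : v k ^ (-((j + 1 : ℕ) : ℤ) * (-r + 2 * (j + 1 : ℕ) + 1)) *
        (v k ^ (1 + 2 * (j : ℤ)) * v k ^ (2 * (q + j + 1) - (2 * q + r))) =
        v k ^ (-(j : ℤ) * (-r + 2 * j + 1)) := by
      rw [← zpow_add₀ hv, ← zpow_add₀ hv]
      congr 1
      push_cast; ring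
    rw [mul_assoc, h4, Nat.cast_succ, ← add_assoc, qfall_succ_left]
    ring
  have h3' := congrArg (algebraMap (RatFunc k) (R k)) h3
  rw [map_mul _ (_ * _), map_mul _ (v k ^ _), map_mul _ (_ * _)] at h3'
  rw [lowCoeff, lowCoeff, inv_units_mul, inv_units_mul, wt, ← h1, ← h2]
  generalize (Tfall (T k) ((j + 1 : ℕ) : ℤ) (j + 1))⁻¹ = D
  generalize (((T k ^ (j + 1))⁻¹ : (R k)ˣ) : R k) = t
  linear_combination (-(-1) ^ j * t * D * (T k : R k) * Tint (T k) ((j : ℤ) + 1)) * h3'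

/-- Projecting the second factor to its coordinate q kills all terms but j = 0 and returns x 0. No
torsion-freeness of V is involved. -/
theorem ne_zero_of_coordinate {n N q : ℕ} (hq : q ≤ n) (c : ℕ → R k) (x : ℕ → V) (f : ℕ → ℕ)
    (hc : c 0 = 1) (hx : x 0 ≠ 0) (hf : f 0 = q) (hf' : ∀ j ∈ Finset.range N, f (j + 1) ≠ q) :
    ∑ j ∈ Finset.range (N + 1), c j • (x j ⊗ₜ[R k] u k (R k) n (f j)) ≠ 0 := by
  intro h
  refine hx ?_
  have h1 := congrArg (TensorProduct.rid (R k) V)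
    (congrArg (LinearMap.lTensor V
      (LinearMap.proj (R := R k) (φ := fun _ : Fin (n + 1) => R k) ⟨q, by omega⟩)) h)
  rw [map_sum, map_sum, map_zero, map_zero, Finset.sum_range_succ', Finset.sum_eq_zero,
    zero_add] at h1
  · rw [map_smul, map_smul, LinearMap.lTensor_tmul, TensorProduct.rid_tmul, hc, one_smul,
      LinearMap.proj_apply, u_apply, if_pos (by simpa using hf.symm), one_smul] at h1
    exact h1
  · intro j hj
    rw [map_smul, map_smul, LinearMap.lTensor_tmul, TensorProduct.rid_tmul,
      LinearMap.proj_apply, u_apply, if_neg (by simpa using (hf' j hj).symm), zero_smul, smul_zero]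

/-- Highest weight vectors in the tensor product of a Verma-type module and `F_n`. -/
theorem isHighestWeightVector_sum {n p : ℕ} (hp : p ≤ n) {w : V}
    (hw : IsHighestWeightVector ρ (wt k (-1)) w) :
    IsHighestWeightVector (tensorRep ρ (finRep k (R k) n)) (wt k ((n : ℤ) - 2 * p - 1))
      (∑ j ∈ Finset.range (p + 1), highCoeff k ((n : ℤ) - p) j •
        (ρ (Fdiv k (R k) j) w ⊗ₜ[R k] u k (R k) n (p - j))) := by
  obtain ⟨hw0, hE, hK⟩ := hw
  refine ⟨ne_zero_of_coordinate (q := p) hp (highCoeff k ((n : ℤ) - p))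
    (fun j => ρ (Fdiv k (R k) j) w) (fun j => p - j) (highCoeff_zero _) ?_ rfl ?_, ?_, ?_⟩
  · rwa [rep_Fdiv_zero]
  · intro j hj
    rw [Finset.mem_range] at hj
    omega
  · rw [map_sum]
    simp only [map_smul, tensorRep_E, smul_add]
    -- The unpaired boundary terms vanish by Ew = 0 and Eu_0 = 0.
    rw [Finset.sum_add_distrib, Finset.sum_range_succ', Finset.sum_range_succ, rep_Fdiv_zero, hE,
      TensorProduct.zero_tmul, smul_zero, add_zero, Nat.sub_self, finRep_E_u_zero,
      TensorProduct.tmul_zero, smul_zero, add_zero, ← Finset.sum_add_distrib]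
    refine Finset.sum_eq_zero fun j hj => ?_
    rw [Finset.mem_range] at hj
    obtain ⟨q, rfl⟩ : ∃ q, p = q + j + 1 := ⟨p - j - 1, by omega⟩
    rw [show q + j + 1 - j = q + 1 by omega, show q + j + 1 - (j + 1) = q by omega,
      finRep_E_u_succ, rep_E_Fdiv_succ ρ hE hK, rep_K_Fdiv ρ hK, TensorProduct.smul_tmul_smul,
      ← TensorProduct.smul_tmul', smul_smul, smul_smul, ← add_smul]
    have h := highCoeff_succ (k := k) ((n : ℤ) - (q + j + 1 : ℕ)) j
    rw [show (n : ℤ) - (q + j + 1 : ℕ) + j + 1 = n - q by push_cast; ring] at h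
    -- [T;-1-j] = -[T⁻¹;j+1] supplies the sign, and explains T⁻¹ in the denominators.
    rw [show (-1 : ℤ) - j = -((j : ℤ) + 1) by ring, Tint_neg, mul_neg, h, neg_add_cancel,
      zero_smul]
  · rw [map_sum, Finset.smul_sum]
    refine Finset.sum_congr rfl fun j hj => ?_
    rw [Finset.mem_range] at hj
    rw [map_smul, tensorRep_K, rep_K_Fdiv ρ hK, finRep_K_u, TensorProduct.smul_tmul_smul, wt_mul,
      smul_comm]
    congr 2
    rw [Nat.cast_sub (by omega)]
    ring

/-- Lowest weight vectors in the tensor product with `F_n`. -/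
theorem isLowestWeightVector_sum {n p : ℕ} (hp : p ≤ n) {m : V}
    (hm : IsLowestWeightVector ρ (wt k 1) m) :
    IsLowestWeightVector (tensorRep ρ (finRep k (R k) n)) (wt k ((n : ℤ) - 2 * p + 1))
      (∑ j ∈ Finset.range (n - p + 1), lowCoeff k p ((n : ℤ) - 2 * p) j •
        (Fneg ρ j m ⊗ₜ[R k] u k (R k) n (p + j))) := by
  obtain ⟨hm0, hF, hK⟩ := hm
  refine ⟨ne_zero_of_coordinate (q := p) hp (lowCoeff k p ((n : ℤ) - 2 * p))
    (fun j => Fneg ρ j m) (fun j => p + j) (lowCoeff_zero _ _) ?_ rfl ?_, ?_, ?_⟩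
  · rwa [Fneg_zero]
  · intro j _
    omega
  · rw [map_sum]
    simp only [map_smul, tensorRep_F, smul_add]
    -- Here the boundary terms vanish by u_{n+1} = 0 and Fm = 0.
    rw [Finset.sum_add_distrib, Finset.sum_range_succ, Finset.sum_range_succ' _ (n - p), Fneg_zero,
      hF, TensorProduct.zero_tmul, smul_zero, add_zero, finRep_F_u, u_eq_zero k (R k) n (by omega),
      smul_zero, TensorProduct.tmul_zero, smul_zero, add_zero, ← Finset.sum_add_distrib]
    refine Finset.sum_eq_zero fun j _ => ?_
    rw [finRep_F_u, rep_F_Fneg_succ ρ hF hK, finRep_Kinv_u, TensorProduct.smul_tmul_smul,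
      TensorProduct.tmul_smul, ← add_assoc, smul_smul, smul_smul, ← add_smul]
    have h := lowCoeff_succ (k := k) p ((n : ℤ) - 2 * p) j
    rw [show 2 * ((p : ℤ) + j + 1) - (2 * p + (n - 2 * p)) = -((n : ℤ) - 2 * (p + j + 1 : ℕ)) by
      push_cast; ring, mul_assoc] at h
    rw [h]
    push_cast
    rw [add_neg_cancel, zero_smul]
  · rw [map_sum, Finset.smul_sum]
    refine Finset.sum_congr rfl fun j _ => ?_
    rw [map_smul, tensorRep_K, rep_K_Fneg ρ hK, finRep_K_u, TensorProduct.smul_tmul_smul, wt_mul,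
      smul_comm]
    congr 2
    push_cast
    ring

/-- Iterate `rep_F_Fneg_succ`; the exponent 2is + i² is the sum of 1 + 2l over s ≤ l < s + i. -/
theorem rep_Fdiv_Fneg {m : V} (hF : ρ (F k (R k)) m = 0)
    (hK : ρ (K k (R k)) m = wt k 1 • m) (s i : ℕ) :
    ρ (Fdiv k (R k) i) (Fneg ρ (s + i) m) =
      (((T k ^ i : (R k)ˣ) : R k) * toR (v k ^ (2 * (i : ℤ) * s + (i : ℤ) ^ 2) * (qfact k i)⁻¹) *
        Tfall (T k) ((s : ℤ) + i) i) • Fneg ρ s m := by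
  induction i generalizing s with
  | zero => simp [rep_Fdiv_zero, qfact_zero, Tfall_zero]
  | succ i ih =>
    have h := ih (s + 1)
    rw [rep_Fdiv_succ, ← add_assoc, add_right_comm, h, map_smul, rep_F_Fneg_succ ρ hF hK, smul_smul,
      smul_smul, Tfall_succ]
    congr 1
    have h1 : v k ^ (2 * (i : ℤ) * (s + 1 : ℕ) + (i : ℤ) ^ 2) * v k ^ (1 + 2 * (s : ℤ)) =
        v k ^ (2 * ((i + 1 : ℕ) : ℤ) * s + ((i + 1 : ℕ) : ℤ) ^ 2) := by
      rw [← zpow_add₀ (v_ne_zero k)]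
      congr 1
      push_cast; ring
    rw [show ((s + 1 : ℕ) : ℤ) + i = s + (i + 1 : ℕ) by push_cast; ring,
      show (s : ℤ) + (i + 1 : ℕ) - i = s + 1 by push_cast; ring, ← h1, qfact_succ, mul_inv, wt,
      pow_succ (T k), Units.val_mul]
    simp only [toR_mul]
    ring

theorem rep_Fdiv_Fneg_eq_zero {m : V} (hF : ρ (F k (R k)) m = 0)
    (hK : ρ (K k (R k)) m = wt k 1 • m) {i j : ℕ} (h : j < i) :
    ρ (Fdiv k (R k) i) (Fneg ρ j m) = 0 := by
  induction i, h using Nat.le_induction with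
  | base =>
    have h0 := rep_Fdiv_Fneg ρ hF hK 0 j
    rw [zero_add] at h0
    rw [rep_Fdiv_succ, h0, map_smul, Fneg_zero, hF, smul_zero, smul_zero]
  | succ i _ ih => rw [rep_Fdiv_succ, ih, map_zero, smul_zero]

end Vectors

/-! ### The scalar sum behind the values of L⁻¹. -/

section Sums

variable (k : Type*) [Field k]

/-- Each factor 1 - v^{-2(q+l+1)} equals v^{-(q+l+1)}(v - v⁻¹)[q+l+1], so the Vandermonde product at
this x is a falling q-factorial. -/
theorem prod_one_sub_eq (q : ℤ) (i : ℕ) :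
    ∏ l ∈ Finset.range i, (1 - v k ^ (-2 * (q + 1)) * v k ^ (-2 * (l : ℤ))) =
      v k ^ (-(i : ℤ) * (q + 1) - ((i * (i - 1) / 2 : ℕ) : ℤ)) *
        ((v k - (v k)⁻¹) ^ i * qfall k (q + i) i) := by
  have hv := v_ne_zero k
  induction i with
  | zero => simp [qfall_zero]
  | succ i ih =>
    have h1 : 1 - v k ^ (-2 * (q + 1)) * v k ^ (-2 * (i : ℤ)) =
        v k ^ (-(q + i + 1)) * ((v k - (v k)⁻¹) * qint k (q + i + 1)) := by
      rw [sub_inv_mul_qint, mul_sub, ← zpow_add₀ hv, ← zpow_add₀ hv, ← zpow_add₀ hv,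
        neg_add_cancel, zpow_zero]
      congr 2
      ring
    have h2 : v k ^ (-((i + 1 : ℕ) : ℤ) * (q + 1) - (((i + 1) * (i + 1 - 1) / 2 : ℕ) : ℤ)) =
        v k ^ (-(i : ℤ) * (q + 1) - ((i * (i - 1) / 2 : ℕ) : ℤ)) * v k ^ (-(q + i + 1)) := by
      rw [← zpow_add₀ hv, succ_choose_two]
      congr 1
      push_cast; ring
    rw [Finset.prod_range_succ, ih, h1, h2, Nat.cast_succ, ← add_assoc, qfall_succ_left]
    ring

theorem two_mul_choose_two (i : ℕ) :
    2 * ((i * (i - 1) / 2 : ℕ) : ℤ) = (i : ℤ) * ((i : ℤ) - 1) := by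
  induction i with
  | zero => simp
  | succ i ih =>
    rw [succ_choose_two]
    generalize ((i * (i - 1) / 2 : ℕ) : ℤ) = τ at ih ⊢
    push_cast
    linarith

/-- The sum of the coefficients that occur in `L⁻¹` of a lowest weight vector. -/
theorem sum_Linv_coeff {n p s : ℕ} (h : p + s ≤ n) :
    ∑ i ∈ Finset.range (n - p - s + 1),
      (v k ^ ((i * (i - 1) / 2 : ℕ) : ℤ) * qbrace k i) *
        ((-1) ^ i * (qfall k ((p : ℤ) + (s + i : ℕ)) (s + i) *
          v k ^ (-((s + i : ℕ) : ℤ) * (-((n : ℤ) - 2 * p) + 2 * (s + i : ℕ) + 1)))) *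
        (v k ^ (2 * (i : ℤ) * s + (i : ℤ) ^ 2) * (qfact k i)⁻¹) *
        (qfall k ((n : ℤ) - (p + s : ℕ)) i * (qfact k i)⁻¹) =
      v k ^ (-2 * ((n : ℤ) - p) * (p + 1)) *
        (v k ^ ((s : ℤ) * (1 - ((n : ℤ) - 2 * p))) * qfall k ((p : ℤ) + s) s) := by
  have hv := v_ne_zero k
  obtain ⟨N, rfl⟩ := Nat.exists_eq_add_of_le h
  have hN : p + s + N - p - s = N := by omega
  -- The value x = v^{-2(p+s+1)} makes the product [p+s+i]_{(i)} up to a scalar; x^N with N = n-p-s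
  -- then supplies the closed form.
  have key := sum_qbinom_mul_prod k N (v k ^ (-2 * (((p : ℤ) + s) + 1)))
  have e0 : v k ^ (-2 * (((p + s + N : ℕ) : ℤ) - p) * (p + 1)) *
      v k ^ ((s : ℤ) * (1 - (((p + s + N : ℕ) : ℤ) - 2 * p))) =
      v k ^ (-(s : ℤ) * (-(((p + s + N : ℕ) : ℤ) - 2 * p) + 2 * s + 1)) *
        (v k ^ (-2 * (((p : ℤ) + s) + 1))) ^ N := by
    rw [← zpow_natCast (v k ^ _), ← zpow_mul, ← zpow_add₀ hv, ← zpow_add₀ hv]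
    congr 1
    push_cast; ring
  rw [← mul_assoc, e0, ← key, Finset.mul_sum, Finset.sum_mul, hN]
  refine Finset.sum_congr rfl fun i _ => ?_
  have hfact := qfact_ne_zero k i
  have e1 : v k ^ ((i * (i - 1) / 2 : ℕ) : ℤ) *
      v k ^ (-((s + i : ℕ) : ℤ) *
        (-(((p + s + N : ℕ) : ℤ) - 2 * p) + 2 * (s + i : ℕ) + 1)) *
      v k ^ (2 * (i : ℤ) * s + (i : ℤ) ^ 2) =
      v k ^ (-(s : ℤ) * (-(((p + s + N : ℕ) : ℤ) - 2 * p) + 2 * s + 1)) *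
        v k ^ ((i : ℤ) * ((N : ℤ) - 1)) *
        v k ^ (-(i : ℤ) * (((p : ℤ) + s) + 1) - ((i * (i - 1) / 2 : ℕ) : ℤ)) := by
    rw [← zpow_add₀ hv, ← zpow_add₀ hv, ← zpow_add₀ hv, ← zpow_add₀ hv]
    congr 1
    have := two_mul_choose_two i
    generalize ((i * (i - 1) / 2 : ℕ) : ℤ) = τ at this ⊢
    push_cast
    linear_combination this
  have e2 : qfall k ((p : ℤ) + (s + i : ℕ)) (s + i) =
      qfall k ((p : ℤ) + s + i) i * qfall k ((p : ℤ) + s) s := by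
    rw [add_comm s i, qfall_add]
    congr 2 <;> push_cast <;> ring
  have e3 : ((p + s + N : ℕ) : ℤ) - (p + s : ℕ) = N := by push_cast; ring
  have e4 : qbrace k i * (qfact k i)⁻¹ = (v k - (v k)⁻¹) ^ i := by
    rw [qbrace_eq, mul_inv_cancel_right₀ hfact]
  rw [prod_one_sub_eq, e2, e3]
  linear_combination
    ((-1) ^ i * qbrace k i * (qfact k i)⁻¹ * qfall k ((p : ℤ) + s + i) i * qfall k ((p : ℤ) + s) s *
      qfall k N i * (qfact k i)⁻¹) * e1 +
    ((-1) ^ i * qfall k ((p : ℤ) + s + i) i * qfall k ((p : ℤ) + s) s *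
      qfall k N i * (qfact k i)⁻¹ *
      (v k ^ (-(s : ℤ) * (-(((p + s + N : ℕ) : ℤ) - 2 * p) + 2 * s + 1)) *
        v k ^ ((i : ℤ) * ((N : ℤ) - 1)) *
        v k ^ (-(i : ℤ) * (((p : ℤ) + s) + 1) - ((i * (i - 1) / 2 : ℕ) : ℤ)))) * e4

end Sums

/-! ### Values of L⁻¹ on the lowest weight vectors. -/

section Vectors

variable {k : Type*} [Field k] {V : Type*} [AddCommGroup V] [Module (R k) V]
  (ρ : QU k (R k) →ₐ[R k] Module.End (R k) V)

/-- The value of `L⁻¹` on the lowest weight vectors. -/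
theorem Linv_sum {n p : ℕ} (hp : p ≤ n) {m : V} (hm : IsLowestWeightVector ρ (wt k 1) m) :
    Linv ρ (finRep k (R k) n)
      (∑ j ∈ Finset.range (n - p + 1), lowCoeff k p ((n : ℤ) - 2 * p) j •
        (Fneg ρ j m ⊗ₜ[R k] u k (R k) n (p + j))) =
      toR (v k ^ (-2 * ((n : ℤ) - p) * (p + 1))) •
        ∑ s ∈ Finset.range (n - p + 1),
          ((-1) ^ s * toR (v k ^ ((s : ℤ) * (1 - ((n : ℤ) - 2 * p))) * qfall k ((p : ℤ) + s) s) *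
            (((T k ^ s : (R k)ˣ) : R k) * Tfall (T k) s s)⁻¹) •
            (Fneg ρ s m ⊗ₜ[R k] u k (R k) n (p + s)) := by
  obtain ⟨-, hF, hK⟩ := hm
  let c : ℕ → R k := fun i => toR (v k ^ ((i * (i - 1) / 2 : ℕ) : ℤ) * qbrace k i)
  -- The i-th term of L⁻¹ applied to summand s+i, which lands on F^{(-s)}m ⊗ u_{p+s}.
  let g : ℕ → ℕ → V ⊗[R k] (Fin (n + 1) → R k) := fun s i =>
    (c i * lowCoeff k p ((n : ℤ) - 2 * p) (s + i)) •
      TensorProduct.map (ρ (Fdiv k (R k) i)) (finRep k (R k) n (Ediv k (R k) i))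
        (Fneg ρ (s + i) m ⊗ₜ[R k] u k (R k) n (p + (s + i)))
  have hg : ∀ s i, g s i =
      (c i * lowCoeff k p ((n : ℤ) - 2 * p) (s + i) *
        ((((T k ^ i : (R k)ˣ) : R k) *
          toR (v k ^ (2 * (i : ℤ) * s + (i : ℤ) ^ 2) * (qfact k i)⁻¹) *
          Tfall (T k) ((s : ℤ) + i) i) *
          toR (qfall k ((n : ℤ) - (p + s : ℕ)) i * (qfact k i)⁻¹))) •
        (Fneg ρ s m ⊗ₜ[R k] u k (R k) n (p + s)) := by
    intro s i
    simp only [g]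
    rw [TensorProduct.map_tmul, rep_Fdiv_Fneg ρ hF hK, ← add_assoc, finRep_Ediv_u,
      TensorProduct.smul_tmul_smul, smul_smul]
  have hL : Linv ρ (finRep k (R k) n)
      (∑ j ∈ Finset.range (n - p + 1), lowCoeff k p ((n : ℤ) - 2 * p) j •
        (Fneg ρ j m ⊗ₜ[R k] u k (R k) n (p + j))) =
      ∑ s ∈ Finset.range (n - p + 1), ∑ i ∈ Finset.range (n - p + 1 - s), g s i := by
    rw [Linv, finsum_map_Fdiv_Ediv ρ _ (finRep_E_pow k (R k) n), ← Finset.sum_range_diag_flip]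
    simp only [map_sum, Finset.smul_sum]
    rw [Finset.sum_comm]
    refine Finset.sum_congr rfl fun j hj => ?_
    rw [Finset.mem_range] at hj
    -- Reindexing by s = j - i is legitimate because terms with i > j vanish, F^{(i)} killing
    -- F^{(-j)}m.
    rw [← Finset.sum_flip (fun s => g s (j - s))]
    symm
    refine Finset.sum_subset_zero_on_sdiff (Finset.range_subset_range.2 (by omega)) ?_ ?_
    · intro i hi
      have := (Finset.mem_sdiff.1 hi).2
      rw [Finset.mem_range, not_lt] at this
      rw [map_smul, TensorProduct.map_tmul, rep_Fdiv_Fneg_eq_zero ρ hF hK (by omega),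
        TensorProduct.zero_tmul, smul_zero, smul_zero]
    · intro i hi
      rw [Finset.mem_range] at hi
      simp only [g]
      rw [show j - (j - i) = i by omega, show j - i + i = j by omega, map_smul, smul_smul]
  rw [hL, Finset.smul_sum]
  refine Finset.sum_congr rfl fun s hs => ?_
  rw [Finset.mem_range] at hs
  simp only [hg]
  rw [← Finset.sum_smul, smul_smul]
  congr 1
  have key := congrArg (algebraMap (RatFunc k) (R k)) (sum_Linv_coeff k (n := n) (p := p) (s := s)
    (by omega))
  rw [map_sum, map_mul] at key
  have h2 : toR (v k ^ (-2 * ((n : ℤ) - p) * (p + 1))) *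
      ((-1) ^ s * toR (v k ^ ((s : ℤ) * (1 - ((n : ℤ) - 2 * p))) * qfall k ((p : ℤ) + s) s) *
            (((T k ^ s : (R k)ˣ) : R k) * Tfall (T k) s s)⁻¹) =
      (toR (v k ^ (-2 * ((n : ℤ) - p) * (p + 1))) *
      toR (v k ^ ((s : ℤ) * (1 - ((n : ℤ) - 2 * p))) * qfall k ((p : ℤ) + s) s)) *
        ((-1) ^ s * (((T k ^ s : (R k)ˣ) : R k) * Tfall (T k) s s)⁻¹) := by ring
  rw [h2, ← key, Finset.sum_mul, show n - p + 1 - s = n - p - s + 1 by omega]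
  refine Finset.sum_congr rfl fun i _ => ?_
  have h3 : (((T k ^ (s + i))⁻¹ : (R k)ˣ) : R k) * ((T k ^ i : (R k)ˣ) : R k) =
      (((T k ^ s)⁻¹ : (R k)ˣ) : R k) := by
    rw [← Units.val_mul, pow_add, mul_inv, inv_mul_cancel_right]
  have h4 := Tfall_mul_inv_Tfall (k := k) constantCoeff_T s i
  simp only [c]
  rw [lowCoeff, inv_units_mul, inv_units_mul, ← h3, ← h4]
  simp only [toR, map_mul, map_pow, map_neg, map_one, pow_add]
  ring

end Vectors

/-! ### A coordinate model of the Verma module. -/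

section VermaModel

variable (k : Type*) [Field k] (a : ℤ)

/-- `E f_j = [j] [T; a+1-j] f_{j-1}` on coordinates, where `f_j = F^j w`. -/
noncomputable def vermaE : Module.End (R k) (ℕ → R k) where
  toFun f i := toR (qint k ((i : ℤ) + 1)) * Tint (T k) (a - i) * f (i + 1)
  map_add' _ _ := funext fun _ => mul_add _ _ _
  map_smul' _ _ := funext fun _ => mul_left_comm _ _ _

/-- `F f_j = f_{j+1}` on coordinates. -/
noncomputable def vermaF : Module.End (R k) (ℕ → R k) where
  toFun f i := Nat.casesOn i 0 f
  map_add' _ _ := funext fun i => by cases i <;> simp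
  map_smul' _ _ := funext fun i => by cases i <;> simp

/-- `K f_j = T v^{a-2j} f_j` on coordinates. -/
noncomputable def vermaK : Module.End (R k) (ℕ → R k) where
  toFun f i := wt k (a - 2 * i) * f i
  map_add' _ _ := funext fun _ => mul_add _ _ _
  map_smul' _ _ := funext fun _ => mul_left_comm _ _ _

/-- `K⁻¹ f_j = T⁻¹ v^{-(a-2j)} f_j` on coordinates. -/
noncomputable def vermaKinv : Module.End (R k) (ℕ → R k) where
  toFun f i := (((T k)⁻¹ : (R k)ˣ) : R k) * toR (v k ^ (-(a - 2 * i))) * f i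
  map_add' _ _ := funext fun _ => mul_add _ _ _
  map_smul' _ _ := funext fun _ => mul_left_comm _ _ _

theorem vermaE_apply (f : ℕ → R k) (i : ℕ) :
    vermaE k a f i = toR (qint k ((i : ℤ) + 1)) * Tint (T k) (a - i) * f (i + 1) := rfl

theorem vermaF_zero (f : ℕ → R k) : vermaF k f 0 = 0 := rfl

theorem vermaF_succ (f : ℕ → R k) (i : ℕ) : vermaF k f (i + 1) = f i := rfl

theorem vermaK_apply (f : ℕ → R k) (i : ℕ) : vermaK k a f i = wt k (a - 2 * i) * f i := rfl

theorem vermaKinv_apply (f : ℕ → R k) (i : ℕ) : vermaKinv k a f i =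
    (((T k)⁻¹ : (R k)ˣ) : R k) * toR (v k ^ (-(a - 2 * i))) * f i := rfl

/-- The Verma module of highest weight `T v^a`, in coordinates with respect to `F^j w`. -/
noncomputable def vermaRep : QU k (R k) →ₐ[R k] Module.End (R k) (ℕ → R k) :=
  lift k (R k) (vermaE k a) (vermaF k) (vermaK k a) (vermaKinv k a)
    (by
      refine LinearMap.ext fun f => funext fun i => ?_
      have hT := qint_mul_Tint_succ (T k) i (a - i)
      have h : Tint (T k) (a - i - i) = toR (v k - (v k)⁻¹)⁻¹ * (wt k (a - 2 * i) -
          (((T k)⁻¹ : (R k)ˣ) : R k) * toR (v k ^ (-(a - 2 * i)))) := by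
        rw [Tint, wt, sub_sub, ← two_mul, mul_comm (T k : R k),
          mul_comm (((T k)⁻¹ : (R k)ˣ) : R k)]
      rw [LinearMap.sub_apply, LinearMap.smul_apply, LinearMap.sub_apply, Pi.sub_apply,
        Pi.smul_apply, Pi.sub_apply, Module.End.mul_apply, Module.End.mul_apply, vermaE_apply,
        vermaF_succ, vermaK_apply, vermaKinv_apply, smul_eq_mul]
      rw [h] at hT
      cases i with
      | zero =>
        rw [vermaF_zero]
        simp only [Nat.cast_zero, qint_zero, map_zero, zero_mul, zero_add, sub_zero] at hT ⊢
        linear_combination -f 0 * hT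
      | succ i =>
        rw [vermaF_succ, vermaE_apply]
        rw [show a - ((i + 1 : ℕ) : ℤ) + 1 = a - i by push_cast; ring] at hT
        push_cast at hT ⊢
        linear_combination -f (i + 1) * hT)
    (by
      refine LinearMap.ext fun f => funext fun i => ?_
      have h := T_inv_mul_wt (k := k) (a - 2 * (i + 1 : ℕ))
      have h' := wt_mul (k := k) (a - 2 * (i + 1 : ℕ)) 2
      rw [show a - 2 * ((i + 1 : ℕ) : ℤ) + 2 = a - 2 * i by push_cast; ring] at h'
      rw [Module.End.mul_apply, Module.End.mul_apply, LinearMap.smul_apply, Pi.smul_apply,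
        vermaK_apply, vermaE_apply, vermaE_apply, vermaKinv_apply, smul_eq_mul, ← h']
      linear_combination (toR (v k ^ (2 : ℤ)) * toR (qint k ((i : ℤ) + 1)) *
        Tint (T k) (a - i) * f (i + 1)) * h)
    (by
      refine LinearMap.ext fun f => funext fun i => ?_
      rw [Module.End.mul_apply, Module.End.mul_apply, LinearMap.smul_apply, Pi.smul_apply,
        vermaK_apply, smul_eq_mul]
      cases i with
      | zero => rw [vermaF_zero, vermaF_zero, mul_zero, mul_zero]
      | succ i =>
        have h := T_inv_mul_wt (k := k) (a - 2 * i)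
        have h' := wt_mul (k := k) (a - 2 * i) (-2)
        rw [show a - 2 * (i : ℤ) + -2 = a - 2 * (i + 1 : ℕ) by push_cast; ring] at h'
        rw [vermaF_succ, vermaF_succ, vermaKinv_apply, ← h']
        linear_combination (toR (v k ^ (-2 : ℤ)) * f i) * h)
    (by
      refine LinearMap.ext fun f => funext fun i => ?_
      rw [Module.End.mul_apply, vermaK_apply, vermaKinv_apply, Module.End.one_apply]
      linear_combination f i * T_inv_mul_wt (k := k) (a - 2 * i))
    (by
      refine LinearMap.ext fun f => funext fun i => ?_
      rw [Module.End.mul_apply, vermaKinv_apply, vermaK_apply, Module.End.one_apply]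
      linear_combination f i * T_inv_mul_wt (k := k) (a - 2 * i))

/-- The Verma module maps to its model. -/
theorem exists_verma_hom : ∃ Φ : Verma k (R k) (wt k a) →+ (ℕ → R k),
    (∀ b x, Φ (b • x) = vermaRep k a b (Φ x)) ∧
      Φ (vermaGen k (R k) (wt k a)) = Pi.single 0 1 := by
  -- This module structure stays local, which is why the result is stated as an additive map with an
  -- equivariance property.
  let _ : Module (QU k (R k)) (ℕ → R k) := Module.compHom _ (vermaRep k a).toRingHom
  have hsmul : ∀ (b : QU k (R k)) (f : ℕ → R k), b • f = vermaRep k a b f := fun _ _ => rfl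
  let φ : QU k (R k) →ₗ[QU k (R k)] (ℕ → R k) :=
    LinearMap.toSpanSingleton (QU k (R k)) (ℕ → R k) (Pi.single 0 1)
  have hφ : vermaIdeal k (R k) (wt k a) ≤ LinearMap.ker φ := by
    refine Submodule.span_le.2 ?_
    have hE : vermaRep k a (E k (R k)) = vermaE k a := lift_E ..
    have hK : vermaRep k a (K k (R k)) = vermaK k a := lift_K ..
    rintro b (rfl | rfl)
    · rw [SetLike.mem_coe, LinearMap.mem_ker, LinearMap.toSpanSingleton_apply, hsmul, hE]
      funext i
      rw [vermaE_apply, Pi.single_eq_of_ne (Nat.succ_ne_zero i), mul_zero, Pi.zero_apply]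
    · rw [SetLike.mem_coe, LinearMap.mem_ker, LinearMap.toSpanSingleton_apply, hsmul, map_sub, hK,
        AlgHom.commutes, LinearMap.sub_apply, Module.algebraMap_end_apply, sub_eq_zero]
      funext i
      rw [vermaK_apply, Pi.smul_apply, smul_eq_mul]
      rcases i with _ | i
      · simp
      · rw [Pi.single_eq_of_ne (Nat.succ_ne_zero i), mul_zero, mul_zero]
  refine ⟨((vermaIdeal k (R k) (wt k a)).liftQ φ hφ).toAddMonoidHom, fun b x => ?_, ?_⟩
  · exact map_smul ((vermaIdeal k (R k) (wt k a)).liftQ φ hφ) b x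
  · exact (Submodule.liftQ_apply _ φ (h := hφ) 1).trans (one_smul (QU k (R k)) (Pi.single 0 1 : ℕ → R k))

end VermaModel

/-! ### The generator w of M and the class of F⁻¹w in M_π. -/

section Generators

variable (k : Type*) [Field k]

theorem vermaGen_ne_zero (a : ℤ) : vermaGen k (R k) (wt k a) ≠ 0 := by
  obtain ⟨Φ, -, hΦ⟩ := exists_verma_hom k a
  intro h
  rw [h, map_zero] at hΦ
  have := congrFun hΦ 0
  rw [Pi.single_eq_same, Pi.zero_apply] at this
  exact zero_ne_one this

theorem E_smul_vermaGen {A : Type*} [CommRing A] [Algebra (RatFunc k) A] (c : A) :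
    E k A • vermaGen k A c = 0 := by
  rw [vermaGen, ← Submodule.Quotient.mk_smul, Submodule.Quotient.mk_eq_zero, smul_eq_mul, mul_one]
  exact Submodule.subset_span (Set.mem_insert _ _)

theorem K_smul_vermaGen {A : Type*} [CommRing A] [Algebra (RatFunc k) A] (c : A) :
    K k A • vermaGen k A c = c • vermaGen k A c := by
  rw [vermaGen, ← Submodule.Quotient.mk_smul, ← Submodule.Quotient.mk_smul,
    Submodule.Quotient.eq, smul_eq_mul, mul_one, ← Algebra.algebraMap_eq_smul_one]
  exact Submodule.subset_span (Set.mem_insert_of_mem _ rfl)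

theorem isHighestWeightVector_w0 : IsHighestWeightVector (rhoM k) (wt k (-1)) (w0 k) :=
  ⟨vermaGen_ne_zero k (-1), E_smul_vermaGen k _, K_smul_vermaGen k _⟩

/-- `w` is not in the image of `F` up to `F`-torsion. -/
theorem F_pow_smul_vermaGen_ne (a : ℤ) (l : ℕ) (x : Verma k (R k) (wt k a)) :
    F k (R k) ^ l • F k (R k) • x ≠ F k (R k) ^ l • vermaGen k (R k) (wt k a) := by
  obtain ⟨Φ, hsmul, hΦ⟩ := exists_verma_hom k a
  have hF : vermaRep k a (F k (R k)) = vermaF k := lift_F ..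
  -- In the model F is an injective shift, so F^l cancels; coordinate 0 is then 0 on the image of F
  -- and 1 at the generator.
  have hinj : Function.Injective (vermaF k) := fun f g h => funext fun i => congrFun h (i + 1)
  intro h
  have h1 := congrArg Φ h
  rw [hsmul, hsmul, hsmul, hΦ, map_pow, hF] at h1
  have hinj' : Function.Injective ⇑(vermaF k ^ l) := by
    rw [Module.End.coe_pow]
    exact hinj.iterate l
  have h2 := congrFun (hinj' h1) 0
  rw [vermaF_zero, Pi.single_eq_same] at h2
  exact zero_ne_one h2

section Localization

variable {k} {A : Type*} [CommRing A] [Algebra (RatFunc k) A] {V : Type*} [AddCommGroup V]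
  [Module (QU k A) V]

/-- `F` as an element of the multiplicative set that it generates. -/
def Fone (k : Type*) [Field k] (A : Type*) [CommRing A] [Algebra (RatFunc k) A] : Fpow k A :=
  ⟨F k A, Submonoid.mem_powers _⟩

theorem F_smul_div_F (x : V) :
    F k A • (x /ₒ Fone k A : LocF k A V) = toLocF k A V x := by
  rw [← OreLocalization.oreDiv_one_smul]
  exact OreLocalization.smul_cancel (s := Fone k A)

/-- The Ore relation reads bF⁻¹ = F⁻¹b' in the localization. -/
theorem smul_div_F {b b' : QU k A} (h : F k A * b = b' * F k A) (x : V) :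
    b • (x /ₒ Fone k A : LocF k A V) = (b' • x) /ₒ Fone k A := by
  rw [← OreLocalization.oreDiv_one_smul, OreLocalization.oreDiv_smul_char b x 1 (Fone k A) b'
    (Fone k A) h, mul_one]

theorem F_smul_FinvPi (x : V) : F k A • FinvPi k A x = 0 := by
  rw [FinvPi, ← Submodule.Quotient.mk_smul, Submodule.Quotient.mk_eq_zero]
  exact ⟨x, (F_smul_div_F x).symm⟩

theorem K_smul_FinvPi [Module A V] [IsScalarTower A (QU k A) V] {x : V} {c : A}
    (h : K k A • x = c • x) :
    K k A • FinvPi k A x = (c * algebraMap (RatFunc k) A (v k ^ (2 : ℤ))) • FinvPi k A x := by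
  have h1 : K k A • (x /ₒ Fone k A : LocF k A V) =
      (c * algebraMap (RatFunc k) A (v k ^ (2 : ℤ))) • (x /ₒ Fone k A : LocF k A V) := by
    -- Scalars are rewritten as elements of U, so that K and the scalar both move past F⁻¹ by
    -- `smul_div_F`; FK = v²KF produces the factor v².
    rw [← OreLocalization.smul_one_smul (M := QU k A)
        (c * algebraMap (RatFunc k) A (v k ^ (2 : ℤ))),
      smul_div_F (b' := algebraMap (RatFunc k) A (v k ^ (2 : ℤ)) • K k A),
      smul_div_F (b' := (c * algebraMap (RatFunc k) A (v k ^ (2 : ℤ))) • 1)]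
    · rw [smul_assoc, h, smul_assoc, one_smul, smul_smul, mul_comm]
    · rw [mul_smul_comm, smul_mul_assoc, mul_one, one_mul]
    · rw [F_mul_K, smul_mul_assoc]
  exact congrArg (Submodule.Quotient.mk (p := LinearMap.range (toLocF k A V))) h1

end Localization

theorem FinvPi_vermaGen_ne_zero (a : ℤ) :
    FinvPi k (R k) (vermaGen k (R k) (wt k a)) ≠ 0 := by
  intro h
  obtain ⟨x, hx⟩ := (Submodule.Quotient.mk_eq_zero _).1 h
  -- If F⁻¹w = ι(x), applying F gives ι(Fx) = ι(w), hence F^l F x = F^l w for some l by the Ore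
  -- criterion for equality.
  have h1 := congrArg (F k (R k) • ·) hx
  rw [← map_smul] at h1
  replace h1 := h1.trans (F_smul_div_F (vermaGen k (R k) (wt k a)))
  obtain ⟨⟨_, l, rfl⟩, b, h2, h3⟩ := OreLocalization.oreDiv_eq_iff.1 h1.symm
  rw [OneMemClass.coe_one, mul_one, mul_one] at h3
  refine F_pow_smul_vermaGen_ne k a l x ?_
  rw [← h3] at h2
  exact h2

theorem isLowestWeightVector_FinvPi :
    IsLowestWeightVector (rhoMpi k) (wt k 1) (FinvPi k (R k) (w0 k)) := by
  refine ⟨FinvPi_vermaGen_ne_zero k (-1), F_smul_FinvPi _, ?_⟩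
  have h := K_smul_FinvPi (K_smul_vermaGen k (wt k (-1)))
  rw [wt_mul] at h
  exact h

end Generators

end QSL2

/-! ### The main theorem. -/

theorem mainTheorem9 (k : Type*) [Field k] [CharZero k] (n p r : ℕ)
    (hr : (n : ℤ) - 2 * p = r) :
    -- `w_{0,-1}` is a highest weight vector, and `F⁻¹ w_{0,-1}` gives a lowest weight vector of `M_π`
    (QSL2.IsHighestWeightVector (QSL2.rhoM k) (QSL2.wt k (-1)) (QSL2.w0 k) ∧
      QSL2.IsLowestWeightVector (QSL2.rhoMpi k) (QSL2.wt k 1)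
        (QSL2.FinvPi k (QSL2.R k) (QSL2.w0 k))) ∧
    -- highest weight vectors of `M ⊗ F_n`
    QSL2.IsHighestWeightVector (QSL2.tensorRep (QSL2.rhoM k) (QSL2.rhoFn k n))
      (QSL2.wt k ((r : ℤ) - 1)) (QSL2.wPlus k n p) ∧
    QSL2.IsHighestWeightVector (QSL2.tensorRep (QSL2.rhoM k) (QSL2.rhoFn k n))
      (QSL2.wt k (-(r : ℤ) - 1)) (QSL2.wMinus k n p) ∧
    -- `L` is invertible on `M_π ⊗ F_n`
    (Function.LeftInverse (QSL2.Linv (QSL2.rhoMpi k) (QSL2.rhoFn k n))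
        (QSL2.L (QSL2.rhoMpi k) (QSL2.rhoFn k n)) ∧
      Function.RightInverse (QSL2.Linv (QSL2.rhoMpi k) (QSL2.rhoFn k n))
        (QSL2.L (QSL2.rhoMpi k) (QSL2.rhoFn k n))) ∧
    -- lowest weight vectors of `M_π ⊗ F_n`, and the values of `L⁻¹` on them
    ∀ m : QSL2.Mpi k, QSL2.IsLowestWeightVector (QSL2.rhoMpi k) (QSL2.wt k 1) m →
      QSL2.IsLowestWeightVector (QSL2.tensorRep (QSL2.rhoMpi k) (QSL2.rhoFn k n))
        (QSL2.wt k ((r : ℤ) + 1)) (QSL2.mPlus n p r m) ∧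
      QSL2.IsLowestWeightVector (QSL2.tensorRep (QSL2.rhoMpi k) (QSL2.rhoFn k n))
        (QSL2.wt k (-(r : ℤ) + 1)) (QSL2.mMinus n p r m) ∧
      QSL2.Linv (QSL2.rhoMpi k) (QSL2.rhoFn k n) (QSL2.mPlus n p r m) =
        QSL2.toR (QSL2.v k ^ (-2 * ((n : ℤ) - p) * (p + 1))) •
          ∑ s ∈ Finset.range (n - p + 1),
            ((-1) ^ s *
              QSL2.toR (QSL2.v k ^ ((s : ℤ) * (1 - r)) * QSL2.qfall k ((p : ℤ) + s) s) *
              (((QSL2.T k ^ s : (QSL2.R k)ˣ) : QSL2.R k) * QSL2.Tfall (QSL2.T k) s s)⁻¹) •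
              (QSL2.Fneg (QSL2.rhoMpi k) s m ⊗ₜ[QSL2.R k] QSL2.uR k n (p + s)) ∧
      QSL2.Linv (QSL2.rhoMpi k) (QSL2.rhoFn k n) (QSL2.mMinus n p r m) =
        QSL2.toR (QSL2.v k ^ (-2 * (p : ℤ) * ((n : ℤ) - p + 1))) •
          ∑ s ∈ Finset.range (p + 1),
            ((-1) ^ s *
              QSL2.toR (QSL2.v k ^ ((s : ℤ) * (1 + r)) * QSL2.qfall k ((n : ℤ) - p + s) s) *
              (((QSL2.T k ^ s : (QSL2.R k)ˣ) : QSL2.R k) * QSL2.Tfall (QSL2.T k) s s)⁻¹) •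
              (QSL2.Fneg (QSL2.rhoMpi k) s m ⊗ₜ[QSL2.R k] QSL2.uR k n (n - p + s)) := by
  have hp : p ≤ n := by omega
  have hp' : n - p ≤ n := Nat.sub_le n p
  have hnp : ((n - p : ℕ) : ℤ) = (n : ℤ) - p := Nat.cast_sub hp
  have hsub : n - (n - p) = p := Nat.sub_sub_self hp
  -- The symmetry p ↔ n - p reverses the sign of r, so the vectors indexed by -r are the general
  -- ones taken at n - p.
  have hr' : (n : ℤ) - 2 * (n - p : ℕ) = -r := by omega
  have hp2 : (n : ℤ) - (n - p : ℕ) = p := by omega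
  have hw := QSL2.isHighestWeightVector_w0 k
  have hEN := QSL2.finRep_E_pow k (QSL2.R k) n
  refine ⟨⟨hw, QSL2.isLowestWeightVector_FinvPi k⟩, ?_, ?_,
    ⟨QSL2.leftInverse_Linv_L _ _ hEN, QSL2.rightInverse_Linv_L _ _ hEN⟩, fun m hm => ?_⟩
  · have h := QSL2.isHighestWeightVector_sum (QSL2.rhoM k) hp hw
    rw [hr] at h
    exact h
  · have h := QSL2.isHighestWeightVector_sum (QSL2.rhoM k) hp' hw
    rw [hr', hp2] at h
    exact h
  · have h1 := QSL2.isLowestWeightVector_sum (QSL2.rhoMpi k) hp hm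
    have h2 := QSL2.isLowestWeightVector_sum (QSL2.rhoMpi k) hp' hm
    have h3 := QSL2.Linv_sum (QSL2.rhoMpi k) hp hm
    have h4 := QSL2.Linv_sum (QSL2.rhoMpi k) hp' hm
    rw [hr] at h1 h3
    rw [hr', hsub, hnp] at h2
    rw [hr', hsub, hp2, hnp] at h4
    simp only [QSL2.lowCoeff, neg_neg, sub_neg_eq_add] at h1 h2 h3 h4
    exact ⟨h1, by simpa only [QSL2.mMinus] using h2, h3, by simpa only [QSL2.mMinus] using h4⟩
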